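/- Let $k\ge 1$ and let $\Theta_o=(\mathbb{R}\times(0,\infty))^k$. For $\theta=(\theta_1,\dots,\theta_k)\in\Theta_o$ with $\theta_i=(\mu_i,\sigma_i)$, let $g(\theta_i,\cdot)$ be the Gaussian density with mean $\mu_i$ and standard deviation $\sigma_i$, and for $w$ in the simplex $S_k=\{w\in\mathbb{R}^k: w_i\ge 0,\ \sum_i w_i=1\}$ write $wg(\theta,\cdot)=\sum_{i=1}^k w_i\,g(\theta_i,\cdot)$. Vectors in $\Theta_o$ with the same set of components are identified, and convergence of parameters means convergence to $0$ of the Hausdorff distance $$h(\theta,\theta')=\max\Big\{\max_i\min_j\|\theta_i-\theta'_j\|,\ \max_i\min_j\|\theta'_i-\theta_j\|\Big\}.$$ Let $\theta^*\in\Theta_o$ have pairwise distinct components $\theta^*_1,\dots,\theta^*_k$, let $w^*\in S_k$ have strictly positive entries, and let $Y_1,Y_2,\dots$ be i.i.d. real random variables with density $f=w^*g(\theta^*,\cdot)$. For every $n\ge1$ let $\hat f_n$ be a (random) probability density belonging to $L_2(\mathbb{R})$. Assume that $\|\hat f_n-f\|_{L_2}\to 0$ almost surely, and that there is a constant $C<\infty$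 such that, almost surely, $\|\hat f_n\|_\infty<C$ for all sufficiently large $n$. For $\theta\in\Theta_o$ let $v^n(\theta)\in S_k$ be any minimizer of $w\mapsto\|\hat f_n-wg(\theta,\cdot)\|_{L_2}$ over $S_k$, and let $$\ell_n(\theta)=\frac1n\sum_{t=1}^n\ln\big(v^n(\theta)g(\theta,Y_t)\big)$$ be the log-pseudo-likelihood. Let $\varepsilon_n\to 0$ be real numbers, and let $\hat\theta_n\in\Theta_o$ be such that, almost surely, $\ell_n(\hat\theta_n)\ge\sup_{\theta\in\Theta_o}\ell_n(\theta)-\varepsilon_n$ for all sufficiently large $n$. Then, almost surely: 1. $\hat\theta_n\to\theta^*$, that is, $h(\hat\theta_n,\theta^*)\to0$; 2. $v^n(\hat\theta_n)\to w^*$ up to the labelling of the components: there are permutations $\pi_n$ of $\{1,\dots,k\}$ such that, for every $i$, the component $(\hat\theta_n)_{\pi_n(i)}$ converges to $\theta^*_i$ and the weight $v^n_{\pi_n(i)}(\hat\theta_n)$ converges to $w^*_i$; 3. $\|v^n(\hat\theta_n)g(\hat\theta_n,\cdot)-f\|_{L_2}\to0$. -/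

import Mathlib

open MeasureTheory ProbabilityTheory Filter Topology
open scoped ENNReal

noncomputable section

namespace GaussMix

/-- The parameter space `(ℝ × (0, ∞))^k`; a component is a pair (mean, standard deviation).
A vector is a representative of the class of all vectors with the same set of components. -/
def paramSpace (k : ℕ) : Set (Fin k → ℝ × ℝ) := {θ | ∀ i, 0 < (θ i).2}

/-- The Gaussian density with mean `p.1` and standard deviation `p.2`. -/
def gauss (p : ℝ × ℝ) (y : ℝ) : ℝ := gaussianPDFReal p.1 (p.2 ^ 2).toNNReal y

/-- The mixture `∑ i, w i * g(θ i, ·)`. -/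
def mixture {k : ℕ} (w : Fin k → ℝ) (θ : Fin k → ℝ × ℝ) (y : ℝ) : ℝ := ∑ i, w i * gauss (θ i) y

/-- The probability law with density `∑ i, w i * g(θ i, ·)`. -/
def mixtureLaw {k : ℕ} (w : Fin k → ℝ) (θ : Fin k → ℝ × ℝ) : Measure ℝ :=
  volume.withDensity fun y => ENNReal.ofReal (mixture w θ y)

/-- The distance of two functions in `L₂(ℝ)`. -/
def l2dist (φ ψ : ℝ → ℝ) : ℝ≥0∞ := eLpNorm (fun y => φ y - ψ y) 2 volume

/-- `φ` is a probability density belonging to `L₂(ℝ)`. -/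
structure IsL2Density (φ : ℝ → ℝ) : Prop where
  memLp : MemLp φ 2 volume
  nonneg : 0 ≤ᵐ[volume] φ
  integral_eq_one : ∫ y, φ y = 1

/-- `w` minimizes `‖φ - ∑ i, w i * g(θ i, ·)‖` over the simplex. -/
def IsL2Weights {k : ℕ} (φ : ℝ → ℝ) (θ : Fin k → ℝ × ℝ) (w : Fin k → ℝ) : Prop :=
  w ∈ stdSimplex ℝ (Fin k) ∧
    IsMinOn (fun w' : Fin k → ℝ => l2dist φ (mixture w' θ)) (stdSimplex ℝ (Fin k)) w

/-- The log-pseudo-likelihood `(1/n) ∑_{t < n} ln (∑ i, v(θ) i * g(θ i, y t))` of the sample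
`y 0, …, y (n - 1)` for the weight function `v`. -/
def logPseudoLik {k : ℕ} (n : ℕ) (y : ℕ → ℝ) (v : (Fin k → ℝ × ℝ) → Fin k → ℝ)
    (θ : Fin k → ℝ × ℝ) : ℝ :=
  (1 / (n : ℝ)) * ∑ t ∈ Finset.range n, Real.log (mixture (v θ) θ (y t))

/-- The Hausdorff distance between the sets of components of two parameter vectors. -/
def classDist {k : ℕ} (θ θ' : Fin k → ℝ × ℝ) : ℝ :=
  Metric.hausdorffDist (Set.range θ) (Set.range θ')

end GaussMix

end

/-!
The proof is Wald's consistency argument, made possible by one feature of the `L₂` weights.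

*Narrow components are harmless.* The Gaussian likelihood is unbounded because a component may
collapse onto an observation. The first-order condition for the `L₂` weights, tested by moving mass
from component `i` to component `j`, gives `w i / σ i ≤ 4 (C + 1 / σ j)` for all `i`, `j`
(`IsL2Weights.weight_mul_inv_le`), where `C` bounds the density estimate. So as long as one standard
deviation stays bounded below, the whole fitted mixture is bounded. If all standard deviations tend
to zero, the bound in terms of the largest one, `s`, lets the log-likelihood grow at most like
`1 / s`, while the observations away from the means, a fixed share of the sample, contribute a
negative multiple of `1 / s ^ 2` (`tendsto_empMean_log_mixture_atBot`).

*Compactness.* Limits are taken along ultrafilters on `ℕ`, for a fixed outcome. Each component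
either has a limit in the parameter space or vanishes uniformly on compact sets that avoid one point
(`component_dichotomy`), so the fitted mixtures are asymptotically at most a subdensity `h`, the
limit of the surviving components. Since the outcome determines `h`, the law of large numbers is
needed simultaneously for all continuous test functions of compact support
(`ae_forall_tendsto_empMean`). It yields `E log f ≤ E log (h + ε f)` for every `ε > 0`
(`integral_log_le_of_asymptotic_bound`): on the left, the likelihood at the true parameters converges
to `E log f`, because the `L₂` weights are consistent there (`tendsto_weights_of_l2dist`).

*Identification.* The information inequality forces `h = f` (`eq_mixture_of_integral_log_le`), and
linear independence of Gaussian densities (`coeff_eq_zero_of_sum_gauss_eq_zero`) then makes the limits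
of parameters and weights a relabelling of the true ones. There are finitely many labellings, so the
best one at each `n` works along the whole sequence (`exists_perm_seq`). The other two conclusions
follow from this one, the last by continuity of mixtures in `L₂` (`tendsto_l2dist_mixture`).
-/

namespace GaussMix

/-! ### Gaussian densities -/

theorem gauss_eq (p : ℝ × ℝ) (y : ℝ) :
    gauss p y = (√(2 * Real.pi * p.2 ^ 2))⁻¹ * Real.exp (-(y - p.1) ^ 2 / (2 * p.2 ^ 2)) := by
  simp [gauss, gaussianPDFReal, Real.coe_toNNReal _ (sq_nonneg p.2)]

theorem gauss_nonneg (p : ℝ × ℝ) (y : ℝ) : 0 ≤ gauss p y := gaussianPDFReal_nonneg _ _ _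

theorem gauss_pos {p : ℝ × ℝ} (hp : 0 < p.2) (y : ℝ) : 0 < gauss p y := by
  rw [gauss_eq]; positivity

theorem gauss_le {p : ℝ × ℝ} (hp : 0 < p.2) (y : ℝ) :
    gauss p y ≤ p.2⁻¹ * Real.exp (-(y - p.1) ^ 2 / (2 * p.2 ^ 2)) := by
  rw [gauss_eq]
  gcongr
  apply Real.le_sqrt_of_sq_le
  nlinarith [Real.pi_gt_three, sq_nonneg p.2]

theorem gauss_le_inv {p : ℝ × ℝ} (hp : 0 < p.2) (y : ℝ) : gauss p y ≤ p.2⁻¹ := by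
  refine (gauss_le hp y).trans (mul_le_of_le_one_right (by positivity) ?_)
  rw [Real.exp_le_one_iff]
  exact div_nonpos_of_nonpos_of_nonneg (by nlinarith [sq_nonneg (y - p.1)]) (by positivity)

theorem toNNReal_sq_ne_zero {p : ℝ × ℝ} (hp : 0 < p.2) : (p.2 ^ 2).toNNReal ≠ 0 := by
  have : 0 < p.2 ^ 2 := by positivity
  simpa using this.ne'

theorem integral_gauss {p : ℝ × ℝ} (hp : 0 < p.2) : ∫ y, gauss p y = 1 :=
  integral_gaussianPDFReal_eq_one _ (toNNReal_sq_ne_zero hp)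

theorem integrable_gauss (p : ℝ × ℝ) : Integrable (gauss p) := integrable_gaussianPDFReal _ _

theorem continuous_gauss (p : ℝ × ℝ) : Continuous (gauss p) := by
  simp only [funext (gauss_eq p)]
  fun_prop

/-- The Gaussian density is jointly continuous in the parameter and the argument. -/
theorem continuousAt_gauss {p : ℝ × ℝ} (hp : 0 < p.2) (y : ℝ) :
    ContinuousAt (fun z : (ℝ × ℝ) × ℝ => gauss z.1 z.2) (p, y) := by
  simp only [gauss_eq]
  have h1 : √(2 * Real.pi * p.2 ^ 2) ≠ 0 := by positivity
  have h2 : 2 * p.2 ^ 2 ≠ 0 := by positivity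
  refine ContinuousAt.mul (ContinuousAt.inv₀ (by fun_prop) h1)
    (ContinuousAt.rexp (ContinuousAt.div (by fun_prop) (by fun_prop) h2))

theorem gauss_sq {p : ℝ × ℝ} (hp : 0 < p.2) (y : ℝ) :
    gauss p y ^ 2 = (2 * √Real.pi * p.2)⁻¹ * gauss (p.1, p.2 / √2) y := by
  rw [gauss_eq, gauss_eq, mul_pow, ← Real.exp_nat_mul]
  have e1 : √(2 * Real.pi * p.2 ^ 2) = √2 * √Real.pi * p.2 := by
    rw [Real.sqrt_mul (by positivity), Real.sqrt_mul (by positivity), Real.sqrt_sq hp.le]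
  have e2 : √(2 * Real.pi * (p.2 / √2) ^ 2) = √Real.pi * p.2 := by
    have : 2 * Real.pi * (p.2 / √2) ^ 2 = Real.pi * p.2 ^ 2 := by
      rw [div_pow, Real.sq_sqrt (by norm_num)]; ring
    rw [this, Real.sqrt_mul (by positivity), Real.sqrt_sq hp.le]
  simp only [e1, e2]
  rw [← mul_assoc]
  congr 1
  · rw [← mul_inv, inv_pow]
    congr 1
    rw [mul_pow, mul_pow, Real.sq_sqrt (by positivity), Real.sq_sqrt (by positivity)]
    ring_nf
    rw [Real.sq_sqrt (by positivity)]
    ring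
  · congr 1
    rw [div_pow, Real.sq_sqrt (by norm_num)]
    field_simp
    ring

theorem integrable_gauss_sq {p : ℝ × ℝ} (hp : 0 < p.2) : Integrable (fun y => gauss p y ^ 2) := by
  simp only [gauss_sq hp]
  exact (integrable_gauss _).const_mul _

theorem memLp_gauss {p : ℝ × ℝ} (hp : 0 < p.2) : MemLp (gauss p) 2 volume :=
  (memLp_two_iff_integrable_sq (continuous_gauss p).aestronglyMeasurable).2 (integrable_gauss_sq hp)

theorem le_integral_gauss_sq {p : ℝ × ℝ} (hp : 0 < p.2) :
    (1 / 4) * p.2⁻¹ ≤ ∫ y, gauss p y ^ 2 := by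
  simp only [gauss_sq hp]
  rw [integral_const_mul, integral_gauss (by positivity), mul_one, mul_inv]
  gcongr
  have : √Real.pi ≤ 2 := by
    rw [Real.sqrt_le_left (by norm_num)]; linarith [Real.pi_lt_four]
  rw [one_div]
  gcongr
  linarith

/-! ### Mixtures -/

section

variable {k : ℕ}

theorem continuous_mixture (w : Fin k → ℝ) (θ : Fin k → ℝ × ℝ) : Continuous (mixture w θ) := by
  unfold mixture
  exact continuous_finsetSum _ fun i _ => (continuous_gauss _).const_mul _

theorem mixture_nonneg {w : Fin k → ℝ} (hw : ∀ i, 0 ≤ w i) (θ : Fin k → ℝ × ℝ) (y : ℝ) :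
    0 ≤ mixture w θ y :=
  Finset.sum_nonneg fun i _ => mul_nonneg (hw i) (gauss_nonneg _ _)

theorem mixture_pos {w : Fin k → ℝ} (hw : w ∈ stdSimplex ℝ (Fin k)) {θ : Fin k → ℝ × ℝ}
    (hθ : θ ∈ paramSpace k) (y : ℝ) : 0 < mixture w θ y := by
  have : ∃ i ∈ Finset.univ, (0 : ℝ) < w i := by
    apply Finset.exists_lt_of_sum_lt
    simp [hw.2]
  obtain ⟨i, -, hi⟩ := this
  exact Finset.sum_pos' (fun i _ => mul_nonneg (hw.1 i) (gauss_nonneg _ _))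
    ⟨i, Finset.mem_univ i, mul_pos hi (gauss_pos (hθ i) y)⟩

theorem integrable_mixture (w : Fin k → ℝ) (θ : Fin k → ℝ × ℝ) : Integrable (mixture w θ) := by
  unfold mixture
  exact integrable_finsetSum _ fun i _ => (integrable_gauss _).const_mul _

theorem integral_mixture (w : Fin k → ℝ) {θ : Fin k → ℝ × ℝ} (hθ : θ ∈ paramSpace k) :
    ∫ y, mixture w θ y = ∑ i, w i := by
  unfold mixture
  rw [integral_finsetSum _ fun i _ => (integrable_gauss _).const_mul _]
  exact Finset.sum_congr rfl fun i _ => by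
    rw [integral_const_mul, integral_gauss (hθ i), mul_one]

theorem memLp_mixture (w : Fin k → ℝ) {θ : Fin k → ℝ × ℝ} (hθ : θ ∈ paramSpace k) :
    MemLp (mixture w θ) 2 volume := by
  unfold mixture
  exact memLp_finsetSum _ fun i _ => (memLp_gauss (hθ i)).const_mul _

/-! ### Suppression of narrow components by the `L₂` weights -/

theorem integral_sq_le_of_eLpNorm_le {a b : ℝ → ℝ} (ha : MemLp a 2 volume) (hb : MemLp b 2 volume)
    (h : eLpNorm a 2 volume ≤ eLpNorm b 2 volume) : ∫ y, a y ^ 2 ≤ ∫ y, b y ^ 2 := by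
  rw [ha.eLpNorm_eq_integral_rpow_norm (by simp) (by simp),
    hb.eLpNorm_eq_integral_rpow_norm (by simp) (by simp),
    ENNReal.ofReal_le_ofReal_iff (by positivity), Real.rpow_le_rpow_iff (by positivity)
      (by positivity) (by simp)] at h
  simpa using h

/-- First-order condition for minimizing the `L₂` norm along a segment `a - t • b`. -/
theorem integral_mul_nonpos_of_eLpNorm_le {a b : ℝ → ℝ} (ha : MemLp a 2 volume)
    (hb : MemLp b 2 volume) {τ : ℝ} (hτ : 0 < τ)
    (h : ∀ t, 0 < t → t ≤ τ → eLpNorm a 2 volume ≤ eLpNorm (fun y => a y - t * b y) 2 volume) :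
    ∫ y, a y * b y ≤ 0 := by
  have hab : Integrable (fun y => a y * b y) := ha.integrable_mul hb
  have key : ∀ t, 0 < t → t ≤ τ → 2 * ∫ y, a y * b y ≤ t * ∫ y, b y ^ 2 := by
    intro t ht htτ
    have h1 := integral_sq_le_of_eLpNorm_le ha (ha.sub (hb.const_mul t)) (h t ht htτ)
    have h2 : ∫ y, (a - fun y => t * b y) y ^ 2
        = (∫ y, a y ^ 2) - 2 * t * (∫ y, a y * b y) + t ^ 2 * ∫ y, b y ^ 2 := by
      have h3 : Integrable (fun y => a y ^ 2 - 2 * t * (a y * b y)) :=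
        ha.integrable_sq.sub (hab.const_mul _)
      rw [← integral_const_mul, ← integral_const_mul, ← integral_sub ha.integrable_sq
        (hab.const_mul _), ← integral_add h3 (hb.integrable_sq.const_mul _)]
      refine integral_congr_ae (ae_of_all _ fun y => ?_)
      simp only [Pi.sub_apply]
      ring
    rw [h2] at h1
    refine le_of_mul_le_mul_left ?_ ht
    linarith
  have hB : 0 ≤ ∫ y, b y ^ 2 := integral_nonneg fun y => sq_nonneg _
  by_contra! hI
  set I := ∫ y, a y * b y
  set B := ∫ y, b y ^ 2
  have h3 := key (min τ (I / (B + 1))) (by positivity) (min_le_left _ _)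
  have h4 : min τ (I / (B + 1)) * B ≤ I / (B + 1) * (B + 1) := by
    gcongr
    · exact min_le_right _ _
    · linarith
  rw [div_mul_cancel₀ _ (by positivity)] at h4
  linarith


/-- Moving mass from component `i` to component `j`. -/
theorem mem_stdSimplex_transfer {w : Fin k → ℝ} (hw : w ∈ stdSimplex ℝ (Fin k)) {i j : Fin k}
    {t : ℝ} (ht : 0 ≤ t) (hti : t ≤ w i) :
    w + (Pi.single j t - Pi.single i t) ∈ stdSimplex ℝ (Fin k) := by
  refine ⟨fun l => ?_, ?_⟩
  · have := hw.1 l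
    have h1 : 0 ≤ (Pi.single j t : Fin k → ℝ) l := by
      rcases eq_or_ne l j with rfl | h <;> simp [*]
    have h2 : (Pi.single i t : Fin k → ℝ) l ≤ w l := by
      rcases eq_or_ne l i with rfl | h <;> simp [*]
    simp only [Pi.add_apply, Pi.sub_apply]
    linarith
  · simp [Finset.sum_add_distrib, hw.2]

theorem mixture_transfer (w : Fin k → ℝ) (θ : Fin k → ℝ × ℝ) (i j : Fin k) (t y : ℝ) :
    mixture (w + (Pi.single j t - Pi.single i t)) θ y
      = mixture w θ y + t * (gauss (θ j) y - gauss (θ i) y) := by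
  simp only [mixture, Pi.add_apply, Pi.sub_apply, add_mul, sub_mul, Finset.sum_add_distrib,
    Finset.sum_sub_distrib]
  simp [Pi.single_apply, mul_sub]

theorem integrable_mul_gauss {φ : ℝ → ℝ} (hφ : MemLp φ 2 volume) {p : ℝ × ℝ} (hp : 0 < p.2) :
    Integrable (fun y => φ y * gauss p y) := hφ.integrable_mul (memLp_gauss hp)

/-- The weight of a narrow component is suppressed by the `L₂` criterion: compared with any other
component `j`, the peak height `w i / σ i` is at most a constant times `C + 1 / σ j`. This comes
from the first-order condition for moving mass from component `i` to component `j`. -/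
theorem IsL2Weights.weight_mul_inv_le {φ : ℝ → ℝ} (hφ : IsL2Density φ) {C : ℝ} (hC : 0 ≤ C)
    (hφC : ∀ᵐ y, φ y ≤ C) {θ : Fin k → ℝ × ℝ} (hθ : θ ∈ paramSpace k) {w : Fin k → ℝ}
    (h : IsL2Weights φ θ w) (i j : Fin k) :
    w i * (θ i).2⁻¹ ≤ 4 * (C + (θ j).2⁻¹) := by
  have hσi := hθ i
  have hσj := hθ j
  rcases (h.1.1 i).eq_or_lt with hi | hi
  · rw [← hi, zero_mul]
    exact mul_nonneg (by norm_num) (add_nonneg hC (inv_nonneg.2 hσj.le))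
  have hm := memLp_mixture w hθ
  have hfoc : ∫ y, (φ y - mixture w θ y) * (gauss (θ j) y - gauss (θ i) y) ≤ 0 := by
    refine integral_mul_nonpos_of_eLpNorm_le (hφ.memLp.sub hm)
      ((memLp_gauss hσj).sub (memLp_gauss hσi)) hi fun t ht hti => ?_
    have := h.2 (mem_stdSimplex_transfer (j := j) h.1 ht.le hti)
    simp only [Set.mem_ofPred_eq, l2dist, mixture_transfer] at this
    simpa [← sub_sub] using this
  have e1 : ∫ y, (φ y - mixture w θ y) * (gauss (θ j) y - gauss (θ i) y)
      = ((∫ y, φ y * gauss (θ j) y) - ∫ y, φ y * gauss (θ i) y)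
        - ((∫ y, mixture w θ y * gauss (θ j) y) - ∫ y, mixture w θ y * gauss (θ i) y) := by
    have a1 := integrable_mul_gauss hφ.memLp hσi
    have a2 := integrable_mul_gauss hφ.memLp hσj
    have a3 := integrable_mul_gauss hm hσi
    have a4 := integrable_mul_gauss hm hσj
    have a5 : Integrable (fun y => φ y * gauss (θ j) y - φ y * gauss (θ i) y) := a2.sub a1
    have a6 : Integrable (fun y => mixture w θ y * gauss (θ j) y - mixture w θ y * gauss (θ i) y) :=
      a4.sub a3
    rw [← integral_sub a2 a1, ← integral_sub a4 a3, ← integral_sub a5 a6]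
    refine integral_congr_ae (ae_of_all _ fun y => ?_)
    ring
  have b1 : 0 ≤ ∫ y, φ y * gauss (θ j) y := by
    refine integral_nonneg_of_ae ?_
    filter_upwards [hφ.nonneg] with y hy
    exact mul_nonneg hy (gauss_nonneg _ _)
  have b2 : ∫ y, φ y * gauss (θ i) y ≤ C := by
    calc ∫ y, φ y * gauss (θ i) y ≤ ∫ y, C * gauss (θ i) y := by
          refine integral_mono_ae (integrable_mul_gauss hφ.memLp hσi)
            ((integrable_gauss _).const_mul C) ?_
          filter_upwards [hφC] with y hy
          exact mul_le_mul_of_nonneg_right hy (gauss_nonneg _ _)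
      _ = C := by rw [integral_const_mul, integral_gauss hσi, mul_one]
  have b3 : ∫ y, mixture w θ y * gauss (θ j) y ≤ (θ j).2⁻¹ := by
    calc ∫ y, mixture w θ y * gauss (θ j) y ≤ ∫ y, mixture w θ y * (θ j).2⁻¹ := by
          refine integral_mono (integrable_mul_gauss hm hσj)
            ((integrable_mixture w θ).mul_const _) fun y => ?_
          exact mul_le_mul_of_nonneg_left (gauss_le_inv hσj y) (mixture_nonneg h.1.1 θ y)
      _ = (θ j).2⁻¹ := by rw [integral_mul_const, integral_mixture w hθ, h.1.2, one_mul]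
  have b4 : w i * ((1 / 4) * (θ i).2⁻¹) ≤ ∫ y, mixture w θ y * gauss (θ i) y := by
    calc w i * ((1 / 4) * (θ i).2⁻¹) ≤ w i * ∫ y, gauss (θ i) y ^ 2 :=
          mul_le_mul_of_nonneg_left (le_integral_gauss_sq hσi) hi.le
      _ = ∫ y, w i * gauss (θ i) y ^ 2 := (integral_const_mul _ _).symm
      _ ≤ ∫ y, mixture w θ y * gauss (θ i) y := by
          refine integral_mono ((integrable_gauss_sq hσi).const_mul _)
            (integrable_mul_gauss hm hσi) fun y => ?_
          simp only [sq, ← mul_assoc]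
          refine mul_le_mul_of_nonneg_right ?_ (gauss_nonneg _ _)
          exact Finset.single_le_sum (f := fun i => w i * gauss (θ i) y)
            (fun l _ => mul_nonneg (h.1.1 l) (gauss_nonneg _ _)) (Finset.mem_univ i)
  linarith

/-! ### Identifiability of Gaussian mixtures -/

/-- Two Gaussian densities whose parameters are ordered by standard deviation, ties being broken
by the mean, have different decay at `+∞`. -/
theorem tendsto_gauss_div_gauss {p q : ℝ × ℝ} (hp : 0 < p.2) (hq : 0 < q.2)
    (h : p.2 < q.2 ∨ p.2 = q.2 ∧ p.1 < q.1) :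
    Tendsto (fun y => gauss p y / gauss q y) atTop (𝓝 0) := by
  have e : ∀ y, gauss p y / gauss q y =
      (√(2 * Real.pi * p.2 ^ 2))⁻¹ / (√(2 * Real.pi * q.2 ^ 2))⁻¹ *
        Real.exp (-(y - p.1) ^ 2 / (2 * p.2 ^ 2) - -(y - q.1) ^ 2 / (2 * q.2 ^ 2)) := by
    intro y
    rw [gauss_eq, gauss_eq, Real.exp_sub, mul_div_mul_comm]
  simp only [e]
  rw [← mul_zero ((√(2 * Real.pi * p.2 ^ 2))⁻¹ / (√(2 * Real.pi * q.2 ^ 2))⁻¹)]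
  refine Tendsto.const_mul _ (Real.tendsto_exp_atBot.comp ?_)
  rcases h with h | ⟨h, h'⟩
  · have ha : 0 < 1 / (2 * p.2 ^ 2) - 1 / (2 * q.2 ^ 2) := by
      rw [sub_pos]
      apply one_div_lt_one_div_of_lt (by positivity)
      nlinarith
    set a := 1 / (2 * p.2 ^ 2) - 1 / (2 * q.2 ^ 2) with ha'
    set b := p.1 / p.2 ^ 2 - q.1 / q.2 ^ 2 with hb'
    have e2 : ∀ y, -(y - p.1) ^ 2 / (2 * p.2 ^ 2) - -(y - q.1) ^ 2 / (2 * q.2 ^ 2)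
        = y * (-a * y + b) + (q.1 ^ 2 / (2 * q.2 ^ 2) - p.1 ^ 2 / (2 * p.2 ^ 2)) := by
      intro y
      rw [ha', hb']
      field_simp
      ring
    simp only [e2]
    refine tendsto_atBot_add_const_right _ _ ?_
    refine Tendsto.atTop_mul_atBot₀ tendsto_id ?_
    exact tendsto_atBot_add_const_right _ _
      (tendsto_id.const_mul_atTop_of_neg (by linarith))
  · have e2 : ∀ y, -(y - p.1) ^ 2 / (2 * p.2 ^ 2) - -(y - q.1) ^ 2 / (2 * q.2 ^ 2)
        = (p.1 - q.1) / q.2 ^ 2 * y + (q.1 ^ 2 - p.1 ^ 2) / (2 * q.2 ^ 2) := by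
      intro y
      rw [h]
      field_simp
      ring
    simp only [e2]
    refine tendsto_atBot_add_const_right _ _ (tendsto_id.const_mul_atTop_of_neg ?_)
    exact div_neg_of_neg_of_pos (by linarith) (by positivity)

/-- Gaussian densities with distinct parameters are linearly independent. -/
theorem coeff_eq_zero_of_sum_gauss_eq_zero {S : Finset (ℝ × ℝ)} (hS : ∀ p ∈ S, 0 < p.2)
    {c : ℝ × ℝ → ℝ} (h : ∀ y, ∑ p ∈ S, c p * gauss p y = 0) : ∀ p ∈ S, c p = 0 := by
  by_contra! hne
  obtain ⟨p₀, hp₀, hcp₀⟩ := hne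
  -- the term that decays most slowly at `+∞` among those with a nonzero coefficient
  obtain ⟨q, hq, hmax⟩ := (S.filter fun p => c p ≠ 0).exists_max_image
    (fun p => toLex (p.2, p.1)) ⟨p₀, by simp [hp₀, hcp₀]⟩
  simp only [Finset.mem_filter] at hq hmax
  have hlim : Tendsto (fun y => ∑ p ∈ S, c p * (gauss p y / gauss q y)) atTop
      (𝓝 (∑ p ∈ S, if p = q then c q else 0)) := by
    refine tendsto_finsetSum _ fun p hp => ?_
    split_ifs with hpq
    · subst hpq
      simp [div_self (gauss_pos (hS _ hp) _).ne']
    · by_cases hcp : c p = 0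
      · simp [hcp]
      · rw [← mul_zero (c p)]
        refine (tendsto_gauss_div_gauss (hS p hp) (hS q hq.1) ?_).const_mul _
        have := hmax p ⟨hp, hcp⟩
        rw [Prod.Lex.toLex_le_toLex] at this
        rcases this with h1 | ⟨h1, h2⟩
        · exact Or.inl h1
        · exact Or.inr ⟨h1, lt_of_le_of_ne h2 fun h3 => hpq (Prod.ext h3 h1)⟩
  have hzero : ∀ y, ∑ p ∈ S, c p * (gauss p y / gauss q y) = 0 := by
    intro y
    simp only [← mul_div_assoc, ← Finset.sum_div, h y, zero_div]
  simp only [hzero, Finset.sum_ite_eq', hq.1, if_true] at hlim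
  exact hq.2 (tendsto_nhds_unique tendsto_const_nhds hlim).symm

/-- Identifiability: if a partial mixture of at most `k` Gaussian densities equals a mixture of
`k` distinct ones with positive weights, the two agree up to labelling. -/
theorem exists_perm_of_mixture_eq {θs : Fin k → ℝ × ℝ} {ws : Fin k → ℝ}
    (hθs : θs ∈ paramSpace k) (hinj : Function.Injective θs) (hws : ∀ i, 0 < ws i)
    {I : Finset (Fin k)} {θ : Fin k → ℝ × ℝ} (hθ : ∀ i ∈ I, 0 < (θ i).2) {w : Fin k → ℝ}
    (h : ∀ y, ∑ i ∈ I, w i * gauss (θ i) y = mixture ws θs y) :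
    ∃ π : Equiv.Perm (Fin k), ∀ i, π i ∈ I ∧ θ (π i) = θs i ∧ w (π i) = ws i := by
  classical
  set S : Finset (ℝ × ℝ) := I.image θ ∪ Finset.univ.image θs with hSdef
  have hθS : ∀ i ∈ I, θ i ∈ S := fun i hi =>
    Finset.mem_union_left _ (Finset.mem_image_of_mem _ hi)
  have hθsS : ∀ i ∈ Finset.univ, θs i ∈ S := fun i hi =>
    Finset.mem_union_right _ (Finset.mem_image_of_mem _ hi)
  have hS : ∀ p ∈ S, 0 < p.2 := by
    intro p hp
    rcases Finset.mem_union.1 hp with hp | hp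
    · obtain ⟨i, hi, rfl⟩ := Finset.mem_image.1 hp
      exact hθ i hi
    · obtain ⟨i, -, rfl⟩ := Finset.mem_image.1 hp
      exact hθs i
  have hc := coeff_eq_zero_of_sum_gauss_eq_zero hS
    (c := fun p => ∑ i ∈ I with θ i = p, w i - ∑ i with θs i = p, ws i) (by
      intro y
      have h1 : ∑ p ∈ S, (∑ i ∈ I with θ i = p, w i) * gauss p y = mixture ws θs y := by
        rw [← h y, ← Finset.sum_fiberwise_of_maps_to hθS]
        refine Finset.sum_congr rfl fun p _ => ?_
        rw [Finset.sum_mul]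
        exact Finset.sum_congr rfl fun i hi => by rw [(Finset.mem_filter.1 hi).2]
      have h2 : ∑ p ∈ S, (∑ i with θs i = p, ws i) * gauss p y = mixture ws θs y := by
        rw [mixture, ← Finset.sum_fiberwise_of_maps_to hθsS]
        refine Finset.sum_congr rfl fun p _ => ?_
        rw [Finset.sum_mul]
        exact Finset.sum_congr rfl fun i hi => by rw [(Finset.mem_filter.1 hi).2]
      simp only [sub_mul, Finset.sum_sub_distrib, h1, h2, sub_self])
  have hfib : ∀ j, ∑ i ∈ I with θ i = θs j, w i = ws j := by
    intro j
    have h1 := hc (θs j) (hθsS j (Finset.mem_univ j))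
    have h2 : (Finset.univ.filter fun i => θs i = θs j) = {j} := by
      ext i; simp [hinj.eq_iff]
    rw [h2, Finset.sum_singleton] at h1
    linarith
  have hex : ∀ j, ∃ i ∈ I, θ i = θs j := by
    intro j
    by_contra! hno
    have := hfib j
    rw [Finset.filter_false_of_mem hno, Finset.sum_empty] at this
    exact (hws j).ne this
  choose f hfI hf using hex
  have hfinj : Function.Injective f := fun a b hab => hinj (by rw [← hf a, ← hf b, hab])
  have hfbij := Finite.injective_iff_bijective.1 hfinj
  refine ⟨Equiv.ofBijective f hfbij, fun j => ⟨hfI j, hf j, ?_⟩⟩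
  have h3 : (I.filter fun i => θ i = θs j) = {f j} := by
    ext i
    simp only [Finset.mem_filter, Finset.mem_singleton]
    constructor
    · rintro ⟨-, hi⟩
      obtain ⟨l, rfl⟩ := hfbij.2 i
      rw [hf l] at hi
      rw [hinj hi]
    · rintro rfl
      exact ⟨hfI j, hf j⟩
  have := hfib j
  rw [h3, Finset.sum_singleton] at this
  exact this

/-! ### The law of a mixture -/

theorem measurable_ofReal_mixture (w : Fin k → ℝ) (θ : Fin k → ℝ × ℝ) :
    Measurable fun y => ENNReal.ofReal (mixture w θ y) :=
  (continuous_mixture w θ).measurable.ennreal_ofReal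

theorem integrable_mixtureLaw_iff {w : Fin k → ℝ} (hw : ∀ i, 0 ≤ w i) (θ : Fin k → ℝ × ℝ)
    {φ : ℝ → ℝ} :
    Integrable φ (mixtureLaw w θ) ↔ Integrable (fun y => mixture w θ y * φ y) := by
  rw [mixtureLaw, integrable_withDensity_iff_integrable_smul' (measurable_ofReal_mixture w θ)
    (by simp)]
  simp [ENNReal.toReal_ofReal (mixture_nonneg hw θ _)]

theorem integral_mixtureLaw {w : Fin k → ℝ} (hw : ∀ i, 0 ≤ w i) (θ : Fin k → ℝ × ℝ)
    (φ : ℝ → ℝ) : ∫ y, φ y ∂(mixtureLaw w θ) = ∫ y, mixture w θ y * φ y := by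
  rw [mixtureLaw, integral_withDensity_eq_integral_toReal_smul (measurable_ofReal_mixture w θ)
    (by simp)]
  simp [ENNReal.toReal_ofReal (mixture_nonneg hw θ _)]

theorem isProbabilityMeasure_mixtureLaw {w : Fin k → ℝ} (hw : w ∈ stdSimplex ℝ (Fin k))
    {θ : Fin k → ℝ × ℝ} (hθ : θ ∈ paramSpace k) : IsProbabilityMeasure (mixtureLaw w θ) := by
  refine ⟨?_⟩
  rw [mixtureLaw, withDensity_apply _ MeasurableSet.univ, Measure.restrict_univ,
    ← ofReal_integral_eq_lintegral_ofReal (integrable_mixture w θ)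
      (ae_of_all _ (mixture_nonneg hw.1 θ)), integral_mixture w hθ, hw.2, ENNReal.ofReal_one]

theorem integrable_gauss_mul_sq {p : ℝ × ℝ} (hp : 0 < p.2) :
    Integrable (fun y => gauss p y * y ^ 2) := by
  have h := (memLp_id_gaussianReal' (μ := p.1) (v := (p.2 ^ 2).toNNReal) 2 (by simp)).integrable_sq
  rw [gaussianReal_of_var_ne_zero _ (toNNReal_sq_ne_zero hp),
    integrable_withDensity_iff_integrable_smul' (measurable_gaussianPDF _ _)
      (ae_of_all _ fun _ => gaussianPDF_lt_top)] at h
  refine h.congr (ae_of_all _ fun y => ?_)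
  simp [toReal_gaussianPDF, gauss]

theorem integrable_sq_mixtureLaw {w : Fin k → ℝ} (hw : ∀ i, 0 ≤ w i) {θ : Fin k → ℝ × ℝ}
    (hθ : θ ∈ paramSpace k) : Integrable (fun y => y ^ 2) (mixtureLaw w θ) := by
  rw [integrable_mixtureLaw_iff hw]
  simp only [mixture, Finset.sum_mul, mul_assoc]
  exact integrable_finsetSum _ fun i _ => (integrable_gauss_mul_sq (hθ i)).const_mul _

theorem mixture_le {w : Fin k → ℝ} (hw : ∀ i, 0 ≤ w i) {θ : Fin k → ℝ × ℝ}
    (hθ : θ ∈ paramSpace k) (y : ℝ) : mixture w θ y ≤ ∑ i, w i * (θ i).2⁻¹ :=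
  Finset.sum_le_sum fun i _ => mul_le_mul_of_nonneg_left (gauss_le_inv (hθ i) y) (hw i)

/-- The mixture law has finite entropy: the logarithm of a mixture has quadratic growth. -/
theorem integrable_log_mixture {w : Fin k → ℝ} (hw : w ∈ stdSimplex ℝ (Fin k))
    {θ : Fin k → ℝ × ℝ} (hθ : θ ∈ paramSpace k) :
    Integrable (fun y => Real.log (mixture w θ y)) (mixtureLaw w θ) := by
  have := isProbabilityMeasure_mixtureLaw hw hθ
  obtain ⟨i, -, hi⟩ : ∃ i ∈ Finset.univ, (0 : ℝ) < w i := by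
    apply Finset.exists_lt_of_sum_lt
    simp [hw.2]
  set p := θ i with hp
  have hp2 : 0 < p.2 := hθ i
  set M := ∑ i, w i * (θ i).2⁻¹ with hM
  have hM0 : 0 ≤ M :=
    Finset.sum_nonneg fun i _ => mul_nonneg (hw.1 i) (inv_nonneg.2 (hθ i).le)
  set a := w i * (√(2 * Real.pi * p.2 ^ 2))⁻¹ with ha
  have ha0 : 0 < a := by positivity
  have hint : Integrable
      (fun y => (M + |Real.log a| + p.1 ^ 2 / p.2 ^ 2) + 1 / p.2 ^ 2 * y ^ 2) (mixtureLaw w θ) :=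
    (integrable_const _).add ((integrable_sq_mixtureLaw hw.1 hθ).const_mul _)
  refine hint.mono' ((Real.measurable_log.comp
    (continuous_mixture w θ).measurable).aestronglyMeasurable) (ae_of_all _ fun y => ?_)
  have h0 := mixture_pos hw hθ y
  have h1 : Real.log (mixture w θ y) ≤ M :=
    (Real.log_le_sub_one_of_pos h0).trans (by linarith [mixture_le hw.1 hθ y])
  have h2 : Real.log a - (y - p.1) ^ 2 / (2 * p.2 ^ 2) ≤ Real.log (mixture w θ y) := by
    have h3 : a * Real.exp (-(y - p.1) ^ 2 / (2 * p.2 ^ 2)) ≤ mixture w θ y := by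
      rw [ha, mul_assoc, ← gauss_eq]
      exact Finset.single_le_sum (f := fun i => w i * gauss (θ i) y)
            (fun l _ => mul_nonneg (hw.1 l) (gauss_nonneg _ _)) (Finset.mem_univ i)
    have h4 := Real.log_le_log (by positivity) h3
    rw [Real.log_mul ha0.ne' (Real.exp_pos _).ne', Real.log_exp, neg_div] at h4
    linarith
  have h5 : (y - p.1) ^ 2 / (2 * p.2 ^ 2) ≤ p.1 ^ 2 / p.2 ^ 2 + 1 / p.2 ^ 2 * y ^ 2 := by
    have : p.1 ^ 2 / p.2 ^ 2 + 1 / p.2 ^ 2 * y ^ 2 - (y - p.1) ^ 2 / (2 * p.2 ^ 2)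
        = (y + p.1) ^ 2 / (2 * p.2 ^ 2) := by
      field_simp
      ring
    have h6 : 0 ≤ (y + p.1) ^ 2 / (2 * p.2 ^ 2) := by positivity
    linarith
  rw [Real.norm_eq_abs, abs_le]
  have h7 : 0 ≤ p.1 ^ 2 / p.2 ^ 2 := by positivity
  have h8 : 0 ≤ 1 / p.2 ^ 2 * y ^ 2 := by positivity
  have h9 := neg_abs_le (Real.log a)
  have h10 := abs_nonneg (Real.log a)
  constructor <;> linarith

/-! ### Continuity in `L₂` and consistency of the weights at the true parameters -/

theorem integral_gauss_sq {p : ℝ × ℝ} (hp : 0 < p.2) :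
    ∫ y, gauss p y ^ 2 = (2 * √Real.pi * p.2)⁻¹ := by
  simp only [gauss_sq hp]
  rw [integral_const_mul, integral_gauss (by positivity), mul_one]

/-- Gaussian densities depend continuously in `L₂` on their parameter. Expanding the square, only
the mixed term needs dominated convergence. -/
theorem tendsto_eLpNorm_gauss_sub {p : ℝ × ℝ} (hp : 0 < p.2) :
    Tendsto (fun q : ℝ × ℝ => eLpNorm (fun y => gauss q y - gauss p y) 2 volume)
      (𝓝 p) (𝓝 0) := by
  have hpos : ∀ᶠ q : ℝ × ℝ in 𝓝 p, p.2 / 2 < q.2 :=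
    continuous_snd.continuousAt.eventually_const_lt (half_lt_self hp)
  have hmix : Tendsto (fun q : ℝ × ℝ => ∫ y, gauss q y * gauss p y) (𝓝 p)
      (𝓝 (∫ y, gauss p y * gauss p y)) := by
    refine tendsto_integral_filter_of_dominated_convergence
      (fun y => (p.2 / 2)⁻¹ * gauss p y) ?_ ?_ ((integrable_gauss p).const_mul _) ?_
    · exact Eventually.of_forall fun q =>
        ((continuous_gauss q).mul (continuous_gauss p)).aestronglyMeasurable
    · filter_upwards [hpos] with q hq
      refine ae_of_all _ fun y => ?_
      have hq0 : 0 < q.2 := (half_pos hp).trans hq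
      rw [Real.norm_of_nonneg (mul_nonneg (gauss_nonneg _ _) (gauss_nonneg _ _))]
      refine mul_le_mul_of_nonneg_right ((gauss_le_inv hq0 y).trans ?_) (gauss_nonneg _ _)
      gcongr
    · refine ae_of_all _ fun y => Tendsto.mul_const _ ?_
      exact (continuousAt_gauss hp y).comp
        (f := fun q : ℝ × ℝ => (q, y)) (continuousAt_id.prodMk continuousAt_const)
  have hsq : Tendsto (fun q : ℝ × ℝ => ∫ y, (gauss q y - gauss p y) ^ 2) (𝓝 p) (𝓝 0) := by
    have h1 : Tendsto (fun q : ℝ × ℝ => (2 * √Real.pi * q.2)⁻¹ + (2 * √Real.pi * p.2)⁻¹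
        - 2 * ∫ y, gauss q y * gauss p y) (𝓝 p) (𝓝 ((2 * √Real.pi * p.2)⁻¹
        + (2 * √Real.pi * p.2)⁻¹ - 2 * ∫ y, gauss p y * gauss p y)) := by
      refine ((Tendsto.inv₀ ?_ (by positivity)).add_const _).sub (hmix.const_mul 2)
      exact (continuous_snd.tendsto p).const_mul _
    have h2 : ∫ y, gauss p y * gauss p y = (2 * √Real.pi * p.2)⁻¹ := by
      rw [← integral_gauss_sq hp]
      simp only [sq]
    rw [h2, ← two_mul, sub_self] at h1
    refine h1.congr' ?_
    filter_upwards [hpos] with q hq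
    have hq0 : 0 < q.2 := (half_pos hp).trans hq
    have hm : Integrable (fun y => gauss q y * gauss p y) :=
      (memLp_gauss hq0).integrable_mul (memLp_gauss hp)
    have hs : Integrable (fun y => gauss q y ^ 2 + gauss p y ^ 2) :=
      (integrable_gauss_sq hq0).add (integrable_gauss_sq hp)
    rw [← integral_gauss_sq hq0, ← integral_gauss_sq hp,
      ← integral_add (integrable_gauss_sq hq0) (integrable_gauss_sq hp), ← integral_const_mul,
      ← integral_sub hs (hm.const_mul 2)]
    refine integral_congr_ae (ae_of_all _ fun y => ?_)
    ring
  have hroot := ENNReal.tendsto_ofReal (hsq.rpow_const (p := (2 : ℝ)⁻¹) (Or.inr (by norm_num)))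
  rw [Real.zero_rpow (by norm_num), ENNReal.ofReal_zero] at hroot
  refine hroot.congr' ?_
  filter_upwards [hpos] with q hq
  have hq0 : 0 < q.2 := (half_pos hp).trans hq
  have hmem : MemLp (fun y => gauss q y - gauss p y) 2 volume :=
    (memLp_gauss hq0).sub (memLp_gauss hp)
  rw [hmem.eLpNorm_eq_integral_rpow_norm (by simp) (by simp)]
  simp

theorem mixture_comp_perm (w : Fin k → ℝ) (θ : Fin k → ℝ × ℝ) (π : Equiv.Perm (Fin k)) :
    mixture (w ∘ π) (θ ∘ π) = mixture w θ :=
  funext fun y => Equiv.sum_comp π fun i => w i * gauss (θ i) y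

/-- Mixtures depend continuously in `L₂` on weights and parameters. -/
theorem tendsto_l2dist_mixture {ι : Type*} {l : Filter ι} {w : ι → Fin k → ℝ}
    {θ : ι → Fin k → ℝ × ℝ} {ws : Fin k → ℝ} {θs : Fin k → ℝ × ℝ} (hθs : θs ∈ paramSpace k)
    (hw : ∀ i, Tendsto (fun n => w n i) l (𝓝 (ws i)))
    (hθ : ∀ i, Tendsto (fun n => θ n i) l (𝓝 (θs i))) :
    Tendsto (fun n => l2dist (mixture (w n) (θ n)) (mixture ws θs)) l (𝓝 0) := by
  have hterm : ∀ i, Tendsto (fun n => ‖w n i‖ₑ * eLpNorm (fun y => gauss (θ n i) y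
      - gauss (θs i) y) 2 volume + ‖w n i - ws i‖ₑ * eLpNorm (gauss (θs i)) 2 volume)
      l (𝓝 0) := by
    intro i
    have h1 : Tendsto (fun n => ‖w n i‖ₑ) l (𝓝 ‖ws i‖ₑ) := (hw i).enorm
    have h2 : Tendsto (fun n => ‖w n i - ws i‖ₑ) l (𝓝 0) := by
      simpa using ((hw i).sub_const (ws i)).enorm
    have h3 := (tendsto_eLpNorm_gauss_sub (hθs i)).comp (hθ i)
    simpa using (ENNReal.Tendsto.mul h1 (Or.inr ENNReal.zero_ne_top) h3
      (Or.inr enorm_ne_top)).add (ENNReal.Tendsto.mul_const h2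
        (Or.inr (memLp_gauss (hθs i)).eLpNorm_ne_top))
  have hsum := tendsto_finsetSum (Finset.univ : Finset (Fin k)) fun i _ => hterm i
  simp only [Finset.sum_const_zero] at hsum
  refine tendsto_of_tendsto_of_tendsto_of_le_of_le tendsto_const_nhds hsum
    (fun _ => zero_le) fun n => ?_
  have e : (fun y => mixture (w n) (θ n) y - mixture ws θs y) = ∑ i, (w n i • (fun y =>
      gauss (θ n i) y - gauss (θs i) y) + (w n i - ws i) • gauss (θs i)) := by
    ext y
    simp only [mixture, ← Finset.sum_sub_distrib, Finset.sum_apply, Pi.add_apply, Pi.smul_apply,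
      smul_eq_mul]
    exact Finset.sum_congr rfl fun i _ => by ring
  have c1 : ∀ i, AEStronglyMeasurable (w n i • (fun y =>
      gauss (θ n i) y - gauss (θs i) y)) (volume : Measure ℝ) := fun i =>
    (((continuous_gauss _).sub (continuous_gauss _)).const_smul _).aestronglyMeasurable
  have c2 : ∀ i, AEStronglyMeasurable ((w n i - ws i) • gauss (θs i)) (volume : Measure ℝ) :=
    fun i => ((continuous_gauss _).const_smul _).aestronglyMeasurable
  rw [l2dist, e]
  refine (eLpNorm_sum_le (fun i _ => (c1 i).add (c2 i)) (by norm_num)).trans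
    (Finset.sum_le_sum fun i _ => ?_)
  refine (eLpNorm_add_le (c1 i) (c2 i) (by norm_num)).trans ?_
  rw [eLpNorm_const_smul, eLpNorm_const_smul]

theorem l2dist_comm (φ ψ : ℝ → ℝ) : l2dist φ ψ = l2dist ψ φ := by
  rw [l2dist, l2dist, ← eLpNorm_neg]
  congr 1
  ext y
  simp

theorem l2dist_triangle {φ ψ χ : ℝ → ℝ} (hφ : MemLp φ 2 volume) (hψ : MemLp ψ 2 volume)
    (hχ : MemLp χ 2 volume) : l2dist φ χ ≤ l2dist φ ψ + l2dist ψ χ := by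
  have : (fun y => φ y - χ y) = (fun y => φ y - ψ y) + fun y => ψ y - χ y := by
    ext y; simp
  rw [l2dist, this]
  exact eLpNorm_add_le (hφ.sub hψ).1 (hψ.sub hχ).1 (by norm_num)

theorem mixture_eq_of_l2dist_eq_zero {w w' : Fin k → ℝ} {θ θ' : Fin k → ℝ × ℝ}
    (h : l2dist (mixture w θ) (mixture w' θ') = 0) : mixture w θ = mixture w' θ' := by
  have hc : Continuous fun y => mixture w θ y - mixture w' θ' y :=
    (continuous_mixture w θ).sub (continuous_mixture w' θ')
  rw [l2dist, eLpNorm_eq_zero_iff hc.aestronglyMeasurable (by norm_num)] at h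
  refine ((continuous_mixture w θ).ae_eq_iff_eq volume (continuous_mixture w' θ')).1 ?_
  filter_upwards [h] with y hy
  exact sub_eq_zero.1 hy

/-- At the true parameters, the `L₂` weights are consistent: the minimizer is at least as close to
`φ n` as the true mixture is, so every limit point of the weights represents the true mixture. -/
theorem tendsto_weights_of_l2dist {θs : Fin k → ℝ × ℝ} {ws : Fin k → ℝ}
    (hθs : θs ∈ paramSpace k) (hinj : Function.Injective θs) (hws : ∀ i, 0 < ws i)
    (hsum : ∑ i, ws i = 1) {φ : ℕ → ℝ → ℝ} (hφ : ∀ᶠ n in atTop, MemLp (φ n) 2 volume)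
    (hlim : Tendsto (fun n => l2dist (φ n) (mixture ws θs)) atTop (𝓝 0))
    {w : ℕ → Fin k → ℝ} (hw : ∀ᶠ n in atTop, IsL2Weights (φ n) θs (w n)) :
    Tendsto w atTop (𝓝 ws) := by
  have hws' : ws ∈ stdSimplex ℝ (Fin k) := ⟨fun i => (hws i).le, hsum⟩
  rw [tendsto_iff_ultrafilter]
  intro U hU
  obtain ⟨w₀, -, hw₀⟩ := (isCompact_stdSimplex ℝ (Fin k)).ultrafilter_le_nhds (U.map w)
    (le_principal_iff.2 (hU (hw.mono fun n hn => hn.1)))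
  have hw₀' : Tendsto w U (𝓝 w₀) := hw₀
  have h1 : Tendsto (fun n => l2dist (mixture (w n) θs) (mixture w₀ θs)) U (𝓝 0) :=
    tendsto_l2dist_mixture hθs (fun i => ((continuous_apply i).tendsto w₀).comp hw₀')
      fun i => tendsto_const_nhds
  have h2 := hlim.mono_left hU
  have h3 : Tendsto (fun _ : ℕ => l2dist (mixture w₀ θs) (mixture ws θs)) U (𝓝 0) := by
    have h4 := h1.add (h2.add h2)
    simp only [add_zero] at h4
    refine tendsto_of_tendsto_of_tendsto_of_le_of_le' tendsto_const_nhds h4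
      (Eventually.of_forall fun _ => zero_le) (hU ?_)
    filter_upwards [hφ, hw] with n hn hwn
    calc l2dist (mixture w₀ θs) (mixture ws θs)
        ≤ l2dist (mixture w₀ θs) (mixture (w n) θs)
          + l2dist (mixture (w n) θs) (mixture ws θs) :=
          l2dist_triangle (memLp_mixture _ hθs) (memLp_mixture _ hθs) (memLp_mixture _ hθs)
      _ ≤ l2dist (mixture (w n) θs) (mixture w₀ θs)
          + (l2dist (φ n) (mixture ws θs) + l2dist (φ n) (mixture ws θs)) := by
          rw [l2dist_comm (mixture w₀ θs)]
          gcongr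
          refine (l2dist_triangle (memLp_mixture _ hθs) hn (memLp_mixture _ hθs)).trans ?_
          gcongr
          rw [l2dist_comm]
          exact hwn.2 hws'
  have h5 := mixture_eq_of_l2dist_eq_zero (tendsto_nhds_unique tendsto_const_nhds h3)
  obtain ⟨π, hπ⟩ := exists_perm_of_mixture_eq hθs hinj hws (I := Finset.univ)
    (fun i _ => hθs i) (w := w₀) (θ := θs) fun y => congrFun h5 y
  have h6 : w₀ = ws := by
    ext i
    rw [← (hπ i).2.2, hinj (hπ i).2.1]
  exact h6 ▸ hw₀'

end

/-! ### Empirical means -/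

section

/-- The mean of `φ` under the empirical distribution of `y 0, …, y (n - 1)`. -/
noncomputable def empMean (n : ℕ) (y : ℕ → ℝ) (φ : ℝ → ℝ) : ℝ :=
  (1 / (n : ℝ)) * ∑ t ∈ Finset.range n, φ (y t)

theorem empMean_mono {n : ℕ} {y : ℕ → ℝ} {φ ψ : ℝ → ℝ} (h : ∀ x, φ x ≤ ψ x) :
    empMean n y φ ≤ empMean n y ψ := by
  unfold empMean
  gcongr
  exact h _

theorem empMean_sub (n : ℕ) (y : ℕ → ℝ) (φ ψ : ℝ → ℝ) :
    empMean n y (fun x => φ x - ψ x) = empMean n y φ - empMean n y ψ := by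
  simp [empMean, Finset.sum_sub_distrib, mul_sub]

theorem empMean_add (n : ℕ) (y : ℕ → ℝ) (φ ψ : ℝ → ℝ) :
    empMean n y (fun x => φ x + ψ x) = empMean n y φ + empMean n y ψ := by
  simp [empMean, Finset.sum_add_distrib, mul_add]

theorem empMean_const_mul (n : ℕ) (y : ℕ → ℝ) (c : ℝ) (φ : ℝ → ℝ) :
    empMean n y (fun x => c * φ x) = c * empMean n y φ := by
  simp only [empMean, ← Finset.mul_sum]
  ring

theorem empMean_const {n : ℕ} (hn : 0 < n) (y : ℕ → ℝ) (c : ℝ) :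
    empMean n y (fun _ => c) = c := by
  have : (n : ℝ) ≠ 0 := by positivity
  simp [empMean, this]

theorem abs_empMean_sub_le {n : ℕ} (hn : 0 < n) (y : ℕ → ℝ) {φ ψ : ℝ → ℝ} {ε : ℝ}
    (h : ∀ x, |φ x - ψ x| ≤ ε) : |empMean n y φ - empMean n y ψ| ≤ ε := by
  rw [← empMean_sub, abs_le]
  constructor
  · rw [← empMean_const hn y (-ε)]
    exact empMean_mono fun x => (abs_le.1 (h x)).1
  · rw [← empMean_const hn y ε]
    exact empMean_mono fun x => (abs_le.1 (h x)).2

variable {Ω : Type*} [MeasurableSpace Ω] {P : Measure Ω} {Y : ℕ → Ω → ℝ} {ν : Measure ℝ}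

theorem ae_tendsto_empMean (hindep : iIndepFun Y P) (hlaw : ∀ t, HasLaw (Y t) ν P) {φ : ℝ → ℝ}
    (hφ : Measurable φ) (hint : Integrable φ ν) :
    ∀ᵐ ω ∂P, Tendsto (fun n => empMean n (fun t => Y t ω) φ) atTop (𝓝 (∫ x, φ x ∂ν)) := by
  have h := strong_law_ae_real (μ := P) (fun t ω => φ (Y t ω)) ?_ ?_ ?_
  · have e : ∫ ω, φ (Y 0 ω) ∂P = ∫ x, φ x ∂ν := by
      rw [← (hlaw 0).map_eq, integral_map (hlaw 0).aemeasurable hφ.aestronglyMeasurable]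
    filter_upwards [h] with ω hω
    rw [e] at hω
    refine hω.congr fun n => ?_
    rw [empMean, div_eq_inv_mul, one_div]
  · have := hint
    rw [← (hlaw 0).map_eq] at this
    exact this.comp_aemeasurable (hlaw 0).aemeasurable
  · intro i j hij
    exact (hindep.indepFun hij).comp hφ hφ
  · intro i
    exact IdentDistrib.comp ⟨(hlaw i).aemeasurable, (hlaw 0).aemeasurable,
      by rw [(hlaw i).map_eq, (hlaw 0).map_eq]⟩ hφ

/-- A continuous cutoff, equal to `1` on `[-N, N]` and to `0` outside `[-(N + 1), N + 1]`. -/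
noncomputable def cutoff (N : ℕ) (x : ℝ) : ℝ := max 0 (min 1 (N + 1 - |x|))

theorem continuous_cutoff (N : ℕ) : Continuous (cutoff N) := by
  unfold cutoff
  fun_prop

theorem cutoff_nonneg (N : ℕ) (x : ℝ) : 0 ≤ cutoff N x := le_max_left _ _

theorem cutoff_le_one (N : ℕ) (x : ℝ) : cutoff N x ≤ 1 := max_le zero_le_one (min_le_left _ _)

theorem cutoff_eq_one {N : ℕ} {x : ℝ} (h : |x| ≤ N) : cutoff N x = 1 := by
  rw [cutoff, min_eq_left (by linarith), max_eq_right zero_le_one]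

theorem cutoff_eq_zero {N : ℕ} {x : ℝ} (h : (N : ℝ) + 1 ≤ |x|) : cutoff N x = 0 := by
  rw [cutoff, max_eq_left]
  exact (min_le_right _ _).trans (by linarith)

theorem hasCompactSupport_cutoff_mul (N : ℕ) (φ : ℝ → ℝ) :
    HasCompactSupport fun x => cutoff N x * φ x := by
  refine HasCompactSupport.intro (isCompact_Icc (a := -((N : ℝ) + 1)) (b := (N : ℝ) + 1))
    fun x hx => ?_
  rw [cutoff_eq_zero, zero_mul]
  by_contra! h
  exact hx (abs_le.1 h.le)

/-- Almost surely, the empirical distributions of an i.i.d. sample converge vaguely to the common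
law. The exceptional set does not depend on the test function because `C(ℝ, ℝ)` is separable for
locally uniform convergence. -/
theorem ae_forall_tendsto_empMean [IsProbabilityMeasure ν] (hindep : iIndepFun Y P)
    (hlaw : ∀ t, HasLaw (Y t) ν P) :
    ∀ᵐ ω ∂P, ∀ φ : ℝ → ℝ, Continuous φ → HasCompactSupport φ →
      Tendsto (fun n => empMean n (fun t => Y t ω) φ) atTop (𝓝 (∫ x, φ x ∂ν)) := by
  have hctbl : ∀ᵐ ω ∂P, ∀ m N : ℕ, Tendsto (fun n => empMean n (fun t => Y t ω)
      fun x => cutoff N x * TopologicalSpace.denseSeq C(ℝ, ℝ) m x) atTop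
      (𝓝 (∫ x, cutoff N x * TopologicalSpace.denseSeq C(ℝ, ℝ) m x ∂ν)) := by
    rw [ae_all_iff]
    intro m
    rw [ae_all_iff]
    intro N
    have hc : Continuous fun x => cutoff N x * TopologicalSpace.denseSeq C(ℝ, ℝ) m x :=
      (continuous_cutoff N).mul (TopologicalSpace.denseSeq C(ℝ, ℝ) m).continuous
    exact ae_tendsto_empMean hindep hlaw hc.measurable
      (hc.integrable_of_hasCompactSupport (hasCompactSupport_cutoff_mul N _))
  filter_upwards [hctbl] with ω hω φ hφ hsupp
  obtain ⟨R, hR⟩ := hsupp.isCompact.isBounded.exists_norm_le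
  obtain ⟨N, hN⟩ := exists_nat_ge R
  have hφN : ∀ x, φ x = cutoff N x * φ x := by
    intro x
    by_cases hx : φ x = 0
    · simp [hx]
    · have := hR x (subset_tsupport φ hx)
      rw [Real.norm_eq_abs] at this
      rw [cutoff_eq_one (this.trans hN), one_mul]
  rw [Metric.tendsto_atTop]
  intro ε hε
  obtain ⟨u, hu, hulim⟩ := mem_closure_iff_seq_limit.1
    (TopologicalSpace.denseRange_denseSeq C(ℝ, ℝ) (⟨φ, hφ⟩ : C(ℝ, ℝ)))
  have hunif := (ContinuousMap.tendsto_iff_forall_isCompact_tendstoUniformlyOn.1 hulim)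
    (Set.Icc (-((N : ℝ) + 1)) (N + 1)) isCompact_Icc
  obtain ⟨a, ha⟩ := (Metric.tendstoUniformlyOn_iff.1 hunif (ε / 4) (by positivity)).exists
  obtain ⟨m, hm⟩ := hu a
  set ψ : ℝ → ℝ := fun x => cutoff N x * TopologicalSpace.denseSeq C(ℝ, ℝ) m x with hψ
  have hclose : ∀ x, |φ x - ψ x| ≤ ε / 4 := by
    intro x
    rw [hφN x, hψ]
    simp only
    rw [← mul_sub, abs_mul, abs_of_nonneg (cutoff_nonneg N x)]
    by_cases hx : |x| ≤ (N : ℝ) + 1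
    · have h1 := ha x (abs_le.1 hx)
      rw [← hm, Real.dist_eq] at h1
      calc _ ≤ 1 * (ε / 4) := mul_le_mul (cutoff_le_one N x) h1.le (abs_nonneg _) zero_le_one
        _ = ε / 4 := one_mul _
    · rw [cutoff_eq_zero (not_le.1 hx).le, zero_mul]
      positivity
  have hcψ : Continuous ψ :=
    (continuous_cutoff N).mul (TopologicalSpace.denseSeq C(ℝ, ℝ) m).continuous
  have hiφ : Integrable φ ν := hφ.integrable_of_hasCompactSupport hsupp
  have hiψ : Integrable ψ ν :=
    hcψ.integrable_of_hasCompactSupport (hasCompactSupport_cutoff_mul N _)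
  have hint : |∫ x, φ x ∂ν - ∫ x, ψ x ∂ν| ≤ ε / 4 := by
    rw [← integral_sub hiφ hiψ]
    have := norm_integral_le_of_norm_le_const (μ := ν) (f := fun x => φ x - ψ x)
      (ae_of_all _ hclose)
    simpa using this
  obtain ⟨n₀, hn₀⟩ := Metric.tendsto_atTop.1 (hω m N) (ε / 4) (by positivity)
  refine ⟨max n₀ 1, fun n hn => ?_⟩
  have h1 := abs_empMean_sub_le (n := n) (by omega) (fun t => Y t ω) hclose
  have h2 := hn₀ n (by omega)
  rw [Real.dist_eq] at h2 ⊢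
  rw [abs_lt] at h2 ⊢
  rw [abs_le] at h1 hint
  constructor <;> linarith [h1.1, h1.2, h2.1, h2.2, hint.1, hint.2]

end

/-! ### Limits of components along ultrafilters -/

section

variable {k : ℕ}

/-- Along an ultrafilter, a real sequence converges or tends to infinity in absolute value. -/
theorem tendsto_nhds_or_tendsto_abs_atTop (U : Ultrafilter ℕ) (x : ℕ → ℝ) :
    (∃ a, Tendsto x U (𝓝 a)) ∨ Tendsto (fun n => |x n|) U atTop := by
  by_cases h : ∃ R, ∀ᶠ n in (U : Filter ℕ), |x n| ≤ R
  · obtain ⟨R, hR⟩ := h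
    obtain ⟨a, -, ha⟩ := (isCompact_Icc (a := -R) (b := R)).ultrafilter_le_nhds (U.map x)
      (le_principal_iff.2 (hR.mono fun n hn => abs_le.1 hn))
    exact Or.inl ⟨a, ha⟩
  · push Not at h
    refine Or.inr (tendsto_atTop.2 fun R => ?_)
    exact (h R).mono fun n hn => hn.le

/-- Along an ultrafilter, a sequence of means stays away from every compact set that avoids one
exceptional point. -/
theorem exists_forall_le_abs_sub (U : Ultrafilter ℕ) (x : ℕ → ℝ) :
    ∃ a, ∀ S : Set ℝ, IsCompact S → a ∉ S →
      ∃ η > 0, ∀ᶠ n in (U : Filter ℕ), ∀ y ∈ S, η ≤ |y - x n| := by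
  rcases tendsto_nhds_or_tendsto_abs_atTop U x with ⟨a, ha⟩ | h
  · refine ⟨a, fun S hS haS => ?_⟩
    obtain ⟨r, hr, hrS⟩ := Metric.isOpen_iff.1 hS.isClosed.isOpen_compl a haS
    refine ⟨r / 2, by positivity, ?_⟩
    filter_upwards [Metric.tendsto_nhds.1 ha (r / 2) (by positivity)] with n hn y hy
    have h1 : r ≤ |y - a| := by
      by_contra! h2
      exact hrS (by rwa [Metric.mem_ball, Real.dist_eq]) hy
    rw [Real.dist_eq] at hn
    have := abs_sub_le y (x n) a
    linarith
  · refine ⟨0, fun S hS _ => ?_⟩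
    obtain ⟨R, hR⟩ := hS.isBounded.exists_norm_le
    refine ⟨1, one_pos, ?_⟩
    filter_upwards [h.eventually_ge_atTop (R + 1)] with n hn y hy
    have h1 := hR y hy
    rw [Real.norm_eq_abs] at h1
    have := abs_sub_abs_le_abs_sub (x n) y
    rw [abs_sub_comm (x n) y] at this
    linarith

/-- The limit behaviour of one weighted component along an ultrafilter, when the peak height stays
bounded: either its parameter converges inside the parameter space, or the component vanishes
uniformly on every compact set that avoids one exceptional point. -/
theorem component_dichotomy (U : Ultrafilter ℕ) {p : ℕ → ℝ × ℝ} (hp : ∀ n, 0 < (p n).2)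
    {w : ℕ → ℝ} (hw : ∀ᶠ n in (U : Filter ℕ), w n ∈ Set.Icc (0 : ℝ) 1) {K : ℝ} (hK₀ : 0 ≤ K)
    (hK : ∀ᶠ n in (U : Filter ℕ), w n * (p n).2⁻¹ ≤ K) :
    (∃ q : ℝ × ℝ, 0 < q.2 ∧ Tendsto p U (𝓝 q)) ∨
      ∃ a, ∀ S : Set ℝ, IsCompact S → a ∉ S → ∀ ε > 0, ∀ᶠ n in (U : Filter ℕ), ∀ y ∈ S,
        w n * gauss (p n) y ≤ ε := by
  have hbound : ∀ᶠ n in (U : Filter ℕ), ∀ y A, A ≤ (y - (p n).1) ^ 2 / (2 * (p n).2 ^ 2) →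
      w n * gauss (p n) y ≤ K * Real.exp (-A) := by
    filter_upwards [hK, hw] with n hn hwn y A hA
    calc w n * gauss (p n) y
        ≤ w n * ((p n).2⁻¹ * Real.exp (-(y - (p n).1) ^ 2 / (2 * (p n).2 ^ 2))) :=
          mul_le_mul_of_nonneg_left (gauss_le (hp n) y) hwn.1
      _ = (w n * (p n).2⁻¹) * Real.exp (-(y - (p n).1) ^ 2 / (2 * (p n).2 ^ 2)) := by ring
      _ ≤ K * Real.exp (-A) := by
          refine mul_le_mul hn (Real.exp_le_exp.2 ?_) (Real.exp_pos _).le hK₀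
          rw [neg_div]
          linarith
  rcases tendsto_nhds_or_tendsto_abs_atTop U (fun n => (p n).2) with ⟨s, hs⟩ | h
  · have hs₀ : 0 ≤ s := ge_of_tendsto' hs fun n => (hp n).le
    rcases hs₀.eq_or_lt with rfl | hs₀
    · right
      obtain ⟨a, ha⟩ := exists_forall_le_abs_sub U fun n => (p n).1
      refine ⟨a, fun S hS haS ε hε => ?_⟩
      obtain ⟨η, hη, hsep⟩ := ha S hS haS
      have hlim : Tendsto (fun n => K * Real.exp (-(η ^ 2 / (2 * (p n).2 ^ 2)))) U (𝓝 0) := by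
        rw [← mul_zero K]
        refine (Real.tendsto_exp_neg_atTop_nhds_zero.comp ?_).const_mul K
        refine Tendsto.const_mul_atTop (f := fun n => (2 * (p n).2 ^ 2)⁻¹) (by positivity) ?_
        refine Tendsto.inv_tendsto_nhdsGT_zero (tendsto_nhdsWithin_iff.2 ⟨?_, ?_⟩)
        · simpa using (hs.pow 2).const_mul 2
        · exact Eventually.of_forall fun n => by
            have := hp n
            simp only [Set.mem_Ioi]
            positivity
      filter_upwards [hbound, hsep, hlim.eventually_le_const hε] with n h1 h2 h3 y hy
      refine (h1 y _ ?_).trans h3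
      have := hp n
      gcongr 1
      rw [← sq_abs (y - _)]
      gcongr
      exact h2 y hy
    · rcases tendsto_nhds_or_tendsto_abs_atTop U (fun n => (p n).1) with ⟨m, hm⟩ | hm
      · exact Or.inl ⟨(m, s), hs₀, hm.prodMk_nhds hs⟩
      · refine Or.inr ⟨0, fun S hS _ ε hε => ?_⟩
        obtain ⟨R, hR⟩ := hS.isBounded.exists_norm_le
        have hlim : Tendsto (fun n => K * Real.exp (-((|(p n).1| - R) ^ 2 / (2 * (2 * s) ^ 2))))
            U (𝓝 0) := by
          rw [← mul_zero K]
          refine (Real.tendsto_exp_neg_atTop_nhds_zero.comp ?_).const_mul K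
          refine Tendsto.atTop_div_const (by positivity) ?_
          refine (tendsto_pow_atTop two_ne_zero).comp ?_
          exact tendsto_atTop_add_const_right _ _ hm
        filter_upwards [hbound, hm.eventually_ge_atTop R, hlim.eventually_le_const hε,
          hs.eventually_le_const (show s < 2 * s by linarith)] with n h1 h2 h3 h4 y hy
        refine (h1 y _ ?_).trans h3
        have := hp n
        have h5 := hR y hy
        rw [Real.norm_eq_abs] at h5
        rw [← sq_abs (y - _)]
        have h6 := abs_sub_abs_le_abs_sub (p n).1 y
        rw [abs_sub_comm (p n).1 y] at h6
        have h7 : 0 ≤ |(p n).1| - R := by linarith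
        gcongr
        linarith
  · refine Or.inr ⟨0, fun S _ _ ε hε => ?_⟩
    filter_upwards [h.eventually_ge_atTop ε⁻¹, hw] with n hn hwn y _
    rw [abs_of_pos (hp n)] at hn
    calc w n * gauss (p n) y ≤ 1 * (p n).2⁻¹ :=
          mul_le_mul hwn.2 (gauss_le_inv (hp n) y) (gauss_nonneg _ _) zero_le_one
      _ ≤ ε := by
          rw [one_mul]
          exact inv_le_of_inv_le₀ hε hn

/-! ### Cutoffs -/

/-- Continuous cutoffs with compact supports that avoid a closed set `D` and exhaust its
complement. -/
theorem exists_cutoff_seq {D : Set ℝ} (hD : IsClosed D) (hne : D.Nonempty) :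
    ∃ (χ : ℕ → ℝ → ℝ) (S : ℕ → Set ℝ), (∀ j, Continuous (χ j)) ∧ (∀ j, IsCompact (S j)) ∧
      (∀ j, ∀ y ∈ S j, y ∉ D) ∧ (∀ j y, 0 ≤ χ j y) ∧ (∀ j y, χ j y ≤ 1) ∧
      (∀ j, ∀ y ∉ S j, χ j y = 0) ∧ ∀ y ∉ D, Tendsto (fun j => χ j y) atTop (𝓝 1) := by
  set ρ : ℝ → ℝ := fun y => min (Metric.infDist y D) (1 + |y|)⁻¹ with hρdef
  have hρ : Continuous ρ := by
    refine (Metric.continuous_infDist_pt D).min (Continuous.inv₀ (by fun_prop) fun y => ?_)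
    positivity
  have hpos : ∀ j : ℕ, (0 : ℝ) < j + 1 := fun j => by positivity
  refine ⟨fun j y => max 0 (min 1 ((j + 1) * ρ y - 1)), fun j => {y | 1 ≤ (j + 1) * ρ y},
    fun j => by fun_prop, fun j => ?_, fun j y hy hyD => ?_, fun j y => le_max_left _ _,
    fun j y => max_le zero_le_one (min_le_left _ _), fun j y hy => ?_, fun y hy => ?_⟩
  · refine Metric.isCompact_of_isClosed_isBounded
      (isClosed_le continuous_const (hρ.const_mul _)) ?_
    refine (Metric.isBounded_closedBall (x := (0 : ℝ)) (r := (j : ℝ) + 1)).subset fun y hy => ?_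
    rw [Metric.mem_closedBall, dist_zero_right, Real.norm_eq_abs]
    have h1 : 1 ≤ (j + 1) * (1 + |y|)⁻¹ :=
      le_trans hy (mul_le_mul_of_nonneg_left (min_le_right _ _) (hpos j).le)
    rw [← div_eq_mul_inv, one_le_div (by positivity)] at h1
    linarith
  · have h1 : (1 : ℝ) ≤ (j + 1) * Metric.infDist y D :=
      le_trans hy (mul_le_mul_of_nonneg_left (min_le_left _ _) (hpos j).le)
    rw [Metric.infDist_zero_of_mem hyD, mul_zero] at h1
    linarith
  · refine max_eq_left ((min_le_right _ _).trans ?_)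
    have : (j + 1) * ρ y < 1 := lt_of_not_ge fun h => hy h
    linarith
  · have h1 : 0 < ρ y :=
      lt_min ((hD.notMem_iff_infDist_pos hne).1 hy) (by positivity)
    refine tendsto_const_nhds.congr' ?_
    have h2 : Tendsto (fun j : ℕ => ((j : ℝ) + 1) * ρ y - 1) atTop atTop := by
      refine tendsto_atTop_add_const_right _ _ (Tendsto.atTop_mul_const h1 ?_)
      exact tendsto_atTop_add_const_right _ _ tendsto_natCast_atTop_atTop
    filter_upwards [h2.eventually_ge_atTop 1] with j hj
    rw [min_eq_left hj, max_eq_right zero_le_one]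

theorem ae_notMem_mixtureLaw {D : Set ℝ} (hD : D.Finite) (w : Fin k → ℝ) (θ : Fin k → ℝ × ℝ) :
    ∀ᵐ y ∂(mixtureLaw w θ), y ∉ D :=
  (withDensity_absolutelyContinuous _ _).ae_le (measure_eq_zero_iff_ae_notMem.1 (hD.measure_zero _))

theorem tendsto_integral_cutoff_mul {ν : Measure ℝ} {D : Set ℝ} (hν : ∀ᵐ y ∂ν, y ∉ D)
    {χ : ℕ → ℝ → ℝ} (hχc : ∀ j, Continuous (χ j)) (hχ₀ : ∀ j y, 0 ≤ χ j y)
    (hχ₁ : ∀ j y, χ j y ≤ 1) (hχ : ∀ y ∉ D, Tendsto (fun j => χ j y) atTop (𝓝 1))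
    {φ : ℝ → ℝ} (hφ : Integrable φ ν) :
    Tendsto (fun j => ∫ y, χ j y * φ y ∂ν) atTop (𝓝 (∫ y, φ y ∂ν)) := by
  refine tendsto_integral_of_dominated_convergence (fun y => ‖φ y‖)
    (fun j => (hχc j).aestronglyMeasurable.mul hφ.1) hφ.norm (fun j => ae_of_all _ fun y => ?_) ?_
  · rw [norm_mul, Real.norm_of_nonneg (hχ₀ j y)]
    exact mul_le_of_le_one_left (norm_nonneg _) (hχ₁ j y)
  · filter_upwards [hν] with y hy
    simpa using (hχ y hy).mul_const (φ y)

/-! ### The information inequality -/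

theorem integrable_log_add_mixture {ws : Fin k → ℝ} (hws : ws ∈ stdSimplex ℝ (Fin k))
    {θs : Fin k → ℝ × ℝ} (hθs : θs ∈ paramSpace k) {h : ℝ → ℝ} (hc : Continuous h)
    (h₀ : ∀ y, 0 ≤ h y) {M : ℝ} (hM : ∀ y, h y ≤ M) {ε : ℝ} (hε : 0 < ε) :
    Integrable (fun y => Real.log (h y + ε * mixture ws θs y)) (mixtureLaw ws θs) := by
  have := isProbabilityMeasure_mixtureLaw hws hθs
  have hlog := integrable_log_mixture hws hθs
  set M' := ∑ i, ws i * (θs i).2⁻¹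
  have hint : Integrable (fun y => |M| + ε * |M'| + |Real.log ε| + |Real.log (mixture ws θs y)|)
      (mixtureLaw ws θs) := (integrable_const _).add hlog.abs
  refine hint.mono' (Real.measurable_log.comp
    (hc.add ((continuous_mixture ws θs).const_mul ε)).measurable).aestronglyMeasurable
    (ae_of_all _ fun y => ?_)
  have hf := mixture_pos hws hθs y
  have hef : 0 < ε * mixture ws θs y := by positivity
  have h1 : Real.log (h y + ε * mixture ws θs y) ≤ |M| + ε * |M'| := by
    refine (Real.log_le_sub_one_of_pos (by linarith [h₀ y])).trans ?_
    have h2 : ε * mixture ws θs y ≤ ε * |M'| :=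
      mul_le_mul_of_nonneg_left ((mixture_le hws.1 hθs y).trans (le_abs_self _)) hε.le
    linarith [hM y, le_abs_self M]
  have h3 : Real.log ε + Real.log (mixture ws θs y) ≤ Real.log (h y + ε * mixture ws θs y) := by
    rw [← Real.log_mul hε.ne' hf.ne']
    exact Real.log_le_log hef (by linarith [h₀ y])
  have h4 := neg_abs_le (Real.log ε)
  have h5 := neg_abs_le (Real.log (mixture ws θs y))
  have h6 : 0 ≤ ε * |M'| := by positivity
  have h7 := abs_nonneg (Real.log ε)
  have h8 := abs_nonneg (Real.log (mixture ws θs y))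
  have h9 := abs_nonneg M
  rw [Real.norm_eq_abs, abs_le]
  constructor <;> linarith

/-- The information inequality with its equality case, for a subdensity `h` in place of a density:
if `h`, regularized by small multiples of the mixture density `f`, has expected log-likelihood at
least that of `f`, then `h = f`. The bound `log x ≤ 2 (√x - 1)` turns the hypothesis into a bound
on the Hellinger distance of `h` and `f`. -/
theorem eq_mixture_of_integral_log_le {ws : Fin k → ℝ} (hws : ws ∈ stdSimplex ℝ (Fin k))
    {θs : Fin k → ℝ × ℝ} (hθs : θs ∈ paramSpace k) {h : ℝ → ℝ} (hc : Continuous h)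
    (h₀ : ∀ y, 0 ≤ h y) {M : ℝ} (hM : ∀ y, h y ≤ M) (hint : Integrable h)
    (hmass : ∫ y, h y ≤ 1)
    (hlog : ∀ ε > 0, ∫ y, Real.log (mixture ws θs y) ∂(mixtureLaw ws θs) ≤
      ∫ y, Real.log (h y + ε * mixture ws θs y) ∂(mixtureLaw ws θs)) (y : ℝ) :
    h y = mixture ws θs y := by
  have := isProbabilityMeasure_mixtureLaw hws hθs
  set f := mixture ws θs with hf
  set ν := mixtureLaw ws θs with hν
  have hfpos : ∀ y, 0 < f y := mixture_pos hws hθs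
  set r : ℝ → ℝ := fun y => h y / f y with hr
  have hr₀ : ∀ y, 0 ≤ r y := fun y => div_nonneg (h₀ y) (hfpos y).le
  have hfr : ∀ y, f y * r y = h y := fun y => mul_div_cancel₀ _ (hfpos y).ne'
  have hrc : Continuous r := hc.div (continuous_mixture ws θs) fun y => (hfpos y).ne'
  have hrint : Integrable r ν := by
    rw [hν, integrable_mixtureLaw_iff hws.1]
    simpa only [← hf, hfr] using hint
  have hrmass : ∫ y, r y ∂ν ≤ 1 := by
    rw [hν, integral_mixtureLaw hws.1]
    simpa only [← hf, hfr] using hmass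
  have hsqrt : ∀ ε > 0, Integrable (fun y => √(r y + ε)) ν := by
    intro ε hε
    refine Integrable.mono' (hrint.add (integrable_const (ε + 1)))
      (by fun_prop) (ae_of_all _ fun y => ?_)
    rw [Real.norm_of_nonneg (Real.sqrt_nonneg _), Pi.add_apply]
    have h1 : 0 ≤ r y + ε := by linarith [hr₀ y]
    nlinarith [Real.sq_sqrt h1, sq_nonneg (√(r y + ε) - 1)]
  have hsq : ∀ ε > 0, ∫ y, (√(r y + ε) - 1) ^ 2 ∂ν ≤ ε := by
    intro ε hε
    have hlogr : Integrable (fun y => Real.log (r y + ε)) ν ∧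
        0 ≤ ∫ y, Real.log (r y + ε) ∂ν := by
      have e : ∀ y, Real.log (r y + ε) = Real.log (h y + ε * f y) - Real.log (f y) := by
        intro y
        rw [← Real.log_div (by nlinarith [h₀ y, hfpos y]) (hfpos y).ne', hr]
        congr 1
        have := (hfpos y).ne'
        field_simp
      have i1 := integrable_log_add_mixture hws hθs hc h₀ hM hε
      have i2 := integrable_log_mixture hws hθs
      simp only [e]
      refine ⟨i1.sub i2, ?_⟩
      rw [integral_sub i1 i2]
      exact sub_nonneg.2 (hlog ε hε)
    have h1 : 0 ≤ ∫ y, 2 * (√(r y + ε) - 1) ∂ν := by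
      refine hlogr.2.trans (integral_mono hlogr.1
        (((hsqrt ε hε).sub (integrable_const 1)).const_mul 2) fun y => ?_)
      have h2 : 0 < r y + ε := by linarith [hr₀ y]
      have h3 := Real.log_le_sub_one_of_pos (Real.sqrt_pos.2 h2)
      rw [Real.log_sqrt h2.le] at h3
      simp only
      linarith
    have e : ∀ y, (√(r y + ε) - 1) ^ 2 = (r y + ε) - 2 * (√(r y + ε) - 1) - 1 := by
      intro y
      have h2 : 0 ≤ r y + ε := by linarith [hr₀ y]
      nlinarith [Real.sq_sqrt h2]
    simp only [e]
    have i1 : Integrable (fun y => 2 * (√(r y + ε) - 1)) ν :=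
      ((hsqrt ε hε).sub (integrable_const 1)).const_mul 2
    have i2 : Integrable (fun y => r y + ε) ν := hrint.add (integrable_const _)
    have i3 : Integrable (fun y => r y + ε - 2 * (√(r y + ε) - 1)) ν := i2.sub i1
    rw [integral_sub i3 (integrable_const _), integral_sub i2 i1,
      integral_add hrint (integrable_const _)]
    simp only [integral_const, probReal_univ, one_smul]
    linarith
  have hlim : Tendsto (fun ε : ℝ => ∫ y, (√(r y + ε) - 1) ^ 2 ∂ν) (𝓝[>] 0)
      (𝓝 (∫ y, (√(r y + 0) - 1) ^ 2 ∂ν)) := by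
    refine tendsto_integral_filter_of_dominated_convergence (fun y => r y + 2)
      (Eventually.of_forall fun ε => by fun_prop) ?_ (hrint.add (integrable_const _)) ?_
    · filter_upwards [Ioo_mem_nhdsGT one_pos] with ε hε
      refine ae_of_all _ fun y => ?_
      have h2 : 0 ≤ r y + ε := by linarith [hr₀ y, hε.1]
      rw [Real.norm_of_nonneg (sq_nonneg _)]
      nlinarith [Real.sq_sqrt h2, Real.sqrt_nonneg (r y + ε), hε.2]
    · refine ae_of_all _ fun y => Tendsto.mono_left ?_ nhdsWithin_le_nhds
      have : Continuous fun ε : ℝ => (√(r y + ε) - 1) ^ 2 := by fun_prop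
      exact this.tendsto 0
  have hle : ∫ y, (√(r y + 0) - 1) ^ 2 ∂ν ≤ 0 :=
    le_of_tendsto_of_tendsto hlim (tendsto_nhdsWithin_of_tendsto_nhds tendsto_id)
      (eventually_nhdsWithin_of_forall fun ε hε => hsq ε hε)
  have hint0 : Integrable (fun y => (√(r y + 0) - 1) ^ 2) ν := by
    refine Integrable.mono' (hrint.add (integrable_const 2)) (by fun_prop)
      (ae_of_all _ fun y => ?_)
    have h2 : 0 ≤ r y + 0 := by linarith [hr₀ y]
    rw [Real.norm_of_nonneg (sq_nonneg _), Pi.add_apply]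
    nlinarith [Real.sq_sqrt h2, Real.sqrt_nonneg (r y + 0)]
  rw [hν, integrable_mixtureLaw_iff hws.1] at hint0
  rw [hν, integral_mixtureLaw hws.1] at hle
  have hcont : Continuous fun y => f y * (√(r y + 0) - 1) ^ 2 :=
    (continuous_mixture ws θs).mul (by fun_prop)
  have hnn : ∀ y, 0 ≤ f y * (√(r y + 0) - 1) ^ 2 :=
    fun y => mul_nonneg (hfpos y).le (sq_nonneg _)
  have hzero := (integral_eq_zero_iff_of_nonneg hnn hint0).1
    (le_antisymm hle (integral_nonneg hnn))
  have hy := congrFun ((hcont.ae_eq_iff_eq volume continuous_const).1 hzero) y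
  have h1 : √(r y + 0) - 1 = 0 := by
    rcases mul_eq_zero.1 hy with h2 | h2
    · exact absurd h2 (hfpos y).ne'
    · exact pow_eq_zero_iff two_ne_zero |>.1 h2
  rw [add_zero, sub_eq_zero, Real.sqrt_eq_one] at h1
  rw [← hfr y, h1, mul_one]

/-! ### Asymptotics of the log-likelihood -/

/-- If all standard deviations tend to zero, the peak heights being controlled by the largest one,
the log-likelihood tends to `-∞`: a fixed share of the observations stays away from all means. -/
theorem tendsto_empMean_log_mixture_atBot {ws : Fin k → ℝ} (hws : ws ∈ stdSimplex ℝ (Fin k))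
    {θs : Fin k → ℝ × ℝ} (hθs : θs ∈ paramSpace k) {U : Ultrafilter ℕ}
    (hU : (U : Filter ℕ) ≤ atTop) {y : ℕ → ℝ}
    (hemp : ∀ φ : ℝ → ℝ, Continuous φ → HasCompactSupport φ →
      Tendsto (fun n => empMean n y φ) atTop (𝓝 (∫ x, φ x ∂(mixtureLaw ws θs))))
    {θ : ℕ → Fin k → ℝ × ℝ} (hθ : ∀ n, θ n ∈ paramSpace k) {w : ℕ → Fin k → ℝ}
    (hw : ∀ᶠ n in (U : Filter ℕ), w n ∈ stdSimplex ℝ (Fin k)) {C : ℝ} (hC : 0 ≤ C) {j : Fin k}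
    (hpeak : ∀ᶠ n in (U : Filter ℕ), ∀ i, w n i * (θ n i).2⁻¹ ≤ 4 * (C + (θ n j).2⁻¹))
    (hj : ∀ᶠ n in (U : Filter ℕ), ∀ i, (θ n i).2 ≤ (θ n j).2)
    (hlim : Tendsto (fun n => (θ n j).2) U (𝓝 0)) :
    Tendsto (fun n => empMean n y fun x => Real.log (mixture (w n) (θ n) x)) U atBot := by
  have := isProbabilityMeasure_mixtureLaw hws hθs
  have hk : (0 : ℝ) < k := by
    have := j.pos
    exact_mod_cast this
  choose a ha using fun i => exists_forall_le_abs_sub U fun n => (θ n i).1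
  obtain ⟨χ, S, hχc, hS, hSD, hχ₀, hχ₁, hχS, hχ⟩ :=
    exists_cutoff_seq (Set.finite_range a).isClosed ⟨a j, j, rfl⟩
  have hmass := tendsto_integral_cutoff_mul
    (ae_notMem_mixtureLaw (Set.finite_range a) ws θs) hχc hχ₀ hχ₁ hχ (integrable_const 1)
  simp only [mul_one, integral_const, probReal_univ, one_smul] at hmass
  obtain ⟨m, hm⟩ := (hmass.eventually_const_lt (show (1 / 2 : ℝ) < 1 by norm_num)).exists
  have hcs : HasCompactSupport (χ m) := HasCompactSupport.intro (hS m) (hχS m)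
  have hχmean := ((hemp _ (hχc m) hcs).mono_left hU).eventually_const_lt hm
  choose η hη hsep using fun i => ha i (S m) (hS m) fun h => hSD m _ h ⟨i, rfl⟩
  obtain ⟨η₀, hη₀le, hη₀⟩ : ∃ η₀ : ℝ, (∀ i, η₀ ≤ η i) ∧ 0 < η₀ := by
    have h1 : ∀ᶠ x in 𝓝[>] (0 : ℝ), ∀ i, x ≤ η i := eventually_all.2 fun i =>
      (eventually_le_nhds (hη i)).filter_mono nhdsWithin_le_nhds
    exact (h1.and self_mem_nhdsWithin).exists
  have hinv : Tendsto (fun n => (θ n j).2⁻¹) U atTop :=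
    Tendsto.inv_tendsto_nhdsGT_zero
      (tendsto_nhdsWithin_iff.2 ⟨hlim, Eventually.of_forall fun n => hθ n j⟩)
  have hbot : Tendsto (fun n => 4 * k * C + (θ n j).2⁻¹ * (4 * k - η₀ ^ 2 / 4 * (θ n j).2⁻¹))
      U atBot := by
    refine tendsto_atBot_add_const_left _ _ (hinv.atTop_mul_atBot₀ ?_)
    simp only [sub_eq_add_neg, ← neg_mul]
    exact tendsto_atBot_add_const_left _ _
      (hinv.const_mul_atTop_of_neg (neg_neg_of_pos (by positivity)))
  refine tendsto_atBot_mono' _ ?_ hbot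
  filter_upwards [hw, hpeak, hj, hχmean, eventually_all.2 hsep,
    hU (eventually_gt_atTop 0)] with n h1 h2 h3 h4 h5 hn
  have hs : 0 < (θ n j).2 := hθ n j
  set s := (θ n j).2 with hsdef
  set B := k * (4 * (C + s⁻¹)) with hB
  have hBpos : 0 < B := by positivity
  have hpt : ∀ x, Real.log (mixture (w n) (θ n) x) ≤ B + -(η₀ ^ 2 / (2 * s ^ 2)) * χ m x := by
    intro x
    have hle : mixture (w n) (θ n) x ≤ B * Real.exp (-(η₀ ^ 2 / (2 * s ^ 2)) * χ m x) := by
      have hterm : ∀ i, w n i * gauss (θ n i) x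
          ≤ 4 * (C + s⁻¹) * Real.exp (-(η₀ ^ 2 / (2 * s ^ 2)) * χ m x) := by
        intro i
        have hσ : 0 < (θ n i).2 := hθ n i
        calc w n i * gauss (θ n i) x ≤ w n i * ((θ n i).2⁻¹ *
              Real.exp (-(x - (θ n i).1) ^ 2 / (2 * (θ n i).2 ^ 2))) :=
              mul_le_mul_of_nonneg_left (gauss_le hσ x) (h1.1 i)
          _ = (w n i * (θ n i).2⁻¹) *
              Real.exp (-(x - (θ n i).1) ^ 2 / (2 * (θ n i).2 ^ 2)) := by ring
          _ ≤ _ := by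
            refine mul_le_mul (h2 i) (Real.exp_le_exp.2 ?_) (Real.exp_pos _).le (by positivity)
            rw [neg_div, neg_mul, neg_le_neg_iff]
            by_cases hx : x ∈ S m
            · have h6 : η₀ ^ 2 / (2 * s ^ 2) * χ m x ≤ η₀ ^ 2 / (2 * s ^ 2) :=
                mul_le_of_le_one_right (by positivity) (hχ₁ m x)
              refine h6.trans ?_
              rw [← sq_abs (x - _)]
              have h7 := (hη₀le i).trans (h5 i x hx)
              have h8 := h3 i
              gcongr
            · rw [hχS m x hx, mul_zero]
              positivity
      calc mixture (w n) (θ n) x ≤ ∑ _i : Fin k, 4 * (C + s⁻¹) *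
            Real.exp (-(η₀ ^ 2 / (2 * s ^ 2)) * χ m x) := Finset.sum_le_sum fun i _ => hterm i
        _ = _ := by simp [hB, mul_assoc]
    have h6 := Real.log_le_log (mixture_pos h1 (hθ n) x) hle
    rw [Real.log_mul hBpos.ne' (Real.exp_pos _).ne', Real.log_exp] at h6
    linarith [Real.log_le_sub_one_of_pos hBpos]
  refine (empMean_mono hpt).trans ?_
  rw [empMean_add, empMean_const hn, empMean_const_mul]
  have h7 : -(η₀ ^ 2 / (2 * s ^ 2)) * empMean n y (χ m) ≤ -(η₀ ^ 2 / (2 * s ^ 2)) * (1 / 2) :=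
    mul_le_mul_of_nonpos_left h4.le (neg_nonpos.2 (by positivity))
  have h8 : B + -(η₀ ^ 2 / (2 * s ^ 2)) * (1 / 2)
      = 4 * k * C + s⁻¹ * (4 * k - η₀ ^ 2 / 4 * s⁻¹) := by
    rw [hB]
    field_simp
    ring
  linarith

/-- If mixtures are bounded by `K` and are asymptotically at most `h` on compact sets avoiding a
finite set `D`, and their log-likelihood is asymptotically at least that of `f`, then `h`
dominates `f` in expected log-likelihood. -/
theorem integral_log_le_of_asymptotic_bound {ws : Fin k → ℝ} (hws : ws ∈ stdSimplex ℝ (Fin k))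
    {θs : Fin k → ℝ × ℝ} (hθs : θs ∈ paramSpace k) {U : Ultrafilter ℕ}
    (hU : (U : Filter ℕ) ≤ atTop) {y : ℕ → ℝ}
    (hemp : ∀ φ : ℝ → ℝ, Continuous φ → HasCompactSupport φ →
      Tendsto (fun n => empMean n y φ) atTop (𝓝 (∫ x, φ x ∂(mixtureLaw ws θs))))
    {m : ℕ → ℝ → ℝ} (hmpos : ∀ᶠ n in (U : Filter ℕ), ∀ x, 0 < m n x) {K : ℝ}
    (hmK : ∀ᶠ n in (U : Filter ℕ), ∀ x, m n x ≤ K) {h : ℝ → ℝ} (hc : Continuous h)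
    (h₀ : ∀ x, 0 ≤ h x) {M : ℝ} (hM : ∀ x, h x ≤ M) {D : Set ℝ} (hD : D.Finite)
    (hne : D.Nonempty)
    (hmh : ∀ S : Set ℝ, IsCompact S → (∀ x ∈ S, x ∉ D) → ∀ ε > 0,
      ∀ᶠ n in (U : Filter ℕ), ∀ x ∈ S, m n x ≤ h x + ε)
    (hlik : ∀ η > 0, ∀ᶠ n in (U : Filter ℕ),
      (∫ x, Real.log (mixture ws θs x) ∂(mixtureLaw ws θs)) - η ≤
        empMean n y fun x => Real.log (m n x))
    {ε : ℝ} (hε : 0 < ε) :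
    ∫ x, Real.log (mixture ws θs x) ∂(mixtureLaw ws θs) ≤
      ∫ x, Real.log (h x + ε * mixture ws θs x) ∂(mixtureLaw ws θs) := by
  have := isProbabilityMeasure_mixtureLaw hws hθs
  set f := mixture ws θs with hf
  set ν := mixtureLaw ws θs with hν
  have hfc : Continuous f := continuous_mixture ws θs
  have hfpos : ∀ x, 0 < f x := mixture_pos hws hθs
  set q : ℝ → ℝ := fun x => h x + ε * f x with hq
  have hqc : Continuous q := hc.add (hfc.const_mul ε)
  have hqpos : ∀ x, 0 < q x := fun x => by
    have := mul_pos hε (hfpos x)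
    have := h₀ x
    simp only [hq]
    linarith
  have hqint : Integrable (fun x => Real.log (q x)) ν :=
    integrable_log_add_mixture hws hθs hc h₀ hM hε
  obtain ⟨χ, S, hχc, hS, hSD, hχ₀, hχ₁, hχS, hχ⟩ := exists_cutoff_seq hD.isClosed hne
  have hcut := (tendsto_integral_cutoff_mul (ae_notMem_mixtureLaw hD ws θs) hχc hχ₀ hχ₁ hχ
    (hqint.sub (integrable_const (Real.log K)))).const_add (Real.log K)
  simp only [Pi.sub_apply] at hcut
  have hfull : Real.log K + ∫ x, (Real.log (q x) - Real.log K) ∂ν = ∫ x, Real.log (q x) ∂ν := by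
    rw [integral_sub hqint (integrable_const _)]
    simp
  rw [← hν, hfull] at hcut
  refine ge_of_tendsto' hcut fun j => ?_
  refine le_of_forall_pos_sub_le fun η hη => ?_
  have hψc : Continuous fun x => χ j x * (Real.log (q x) - Real.log K) :=
    (hχc j).mul ((hqc.log fun x => (hqpos x).ne').sub continuous_const)
  have hψs : HasCompactSupport fun x => χ j x * (Real.log (q x) - Real.log K) :=
    HasCompactSupport.intro (hS j) fun x hx => by rw [hχS j x hx, zero_mul]
  refine ge_of_tendsto (((hemp _ hψc hψs).mono_left hU).const_add (Real.log K)) ?_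
  -- `f` is bounded below on the support of the cutoff, so the slack `ε * f` absorbs the error
  obtain ⟨c, hcpos, hcf⟩ : ∃ c > 0, ∀ x ∈ S j, c ≤ f x := by
    rcases (S j).eq_empty_or_nonempty with he | hSne
    · exact ⟨1, one_pos, by simp [he]⟩
    · obtain ⟨x₀, -, hx₀⟩ := (hS j).exists_isMinOn hSne hfc.continuousOn
      exact ⟨f x₀, hfpos x₀, fun x hx => hx₀ hx⟩
  filter_upwards [hmpos, hmK, hmh (S j) (hS j) (hSD j) (ε * c) (by positivity), hlik η hη,
    hU (eventually_gt_atTop 0)] with n h1 h2 h3 h4 hn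
  refine h4.trans ?_
  rw [← empMean_const hn y (Real.log K), ← empMean_add, empMean_const hn]
  refine empMean_mono fun x => ?_
  have hlK := Real.log_le_log (h1 x) (h2 x)
  by_cases hx : x ∈ S j
  · have hlq : Real.log (m n x) ≤ Real.log (q x) := by
      refine Real.log_le_log (h1 x) ((h3 x hx).trans ?_)
      have := mul_le_mul_of_nonneg_left (hcf x hx) hε.le
      simp only [hq]
      linarith
    have e1 := mul_le_mul_of_nonneg_left hlq (hχ₀ j x)
    have e2 := mul_le_mul_of_nonneg_left hlK (sub_nonneg.2 (hχ₁ j x))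
    linarith
  · rw [hχS j x hx]
    linarith

/-! ### Convergence along ultrafilters -/

/-- Along any ultrafilter, parameters and weights with asymptotically maximal likelihood and
controlled peak heights converge to the true ones, up to a fixed labelling. -/
theorem exists_perm_tendsto_ultrafilter {ws : Fin k → ℝ} (hwpos : ∀ i, 0 < ws i)
    (hwsum : ∑ i, ws i = 1) {θs : Fin k → ℝ × ℝ} (hθs : θs ∈ paramSpace k)
    (hinj : Function.Injective θs) {U : Ultrafilter ℕ}
    (hU : (U : Filter ℕ) ≤ atTop) {y : ℕ → ℝ}
    (hemp : ∀ φ : ℝ → ℝ, Continuous φ → HasCompactSupport φ →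
      Tendsto (fun n => empMean n y φ) atTop (𝓝 (∫ x, φ x ∂(mixtureLaw ws θs))))
    {θ : ℕ → Fin k → ℝ × ℝ} (hθ : ∀ n, θ n ∈ paramSpace k) {w : ℕ → Fin k → ℝ}
    (hw : ∀ᶠ n in (U : Filter ℕ), w n ∈ stdSimplex ℝ (Fin k)) {C : ℝ} (hC : 0 ≤ C)
    (hpeak : ∀ᶠ n in (U : Filter ℕ), ∀ i j, w n i * (θ n i).2⁻¹ ≤ 4 * (C + (θ n j).2⁻¹))
    (hlik : ∀ η > 0, ∀ᶠ n in (U : Filter ℕ),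
      (∫ x, Real.log (mixture ws θs x) ∂(mixtureLaw ws θs)) - η ≤
        empMean n y fun x => Real.log (mixture (w n) (θ n) x)) :
    ∃ π : Equiv.Perm (Fin k), (∀ i, Tendsto (fun n => θ n (π i)) U (𝓝 (θs i))) ∧
      ∀ i, Tendsto (fun n => w n (π i)) U (𝓝 (ws i)) := by
  classical
  have hws : ws ∈ stdSimplex ℝ (Fin k) := ⟨fun i => (hwpos i).le, hwsum⟩
  have hk : Nonempty (Fin k) := by
    by_contra hno
    rw [not_nonempty_iff] at hno
    simp at hwsum
  have hk₀ : (0 : ℝ) < k := by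
    have := hk.some.pos
    exact_mod_cast this
  -- by finiteness, one index `j` carries the largest standard deviation along the ultrafilter
  obtain ⟨j, hj⟩ : ∃ j, ∀ᶠ n in (U : Filter ℕ), ∀ i, (θ n i).2 ≤ (θ n j).2 :=
    Ultrafilter.eventually_exists_iff.1
      (Eventually.of_forall fun n => Finite.exists_max fun i => (θ n i).2)
  -- this standard deviation stays away from zero, for otherwise the likelihood would collapse
  obtain ⟨δ, hδ, hδj⟩ : ∃ δ > 0, ∀ᶠ n in (U : Filter ℕ), δ ≤ (θ n j).2 := by
    by_contra! hno
    have hlim : Tendsto (fun n => (θ n j).2) U (𝓝 0) := by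
      rw [Metric.tendsto_nhds]
      intro δ hδ
      have h1 : ∀ᶠ n in (U : Filter ℕ), (θ n j).2 < δ :=
        (Ultrafilter.frequently_iff_eventually.1 (by simpa using hno δ hδ))
      filter_upwards [h1] with n hn
      rwa [dist_zero_right, Real.norm_of_nonneg (hθ n j).le]
    have hbot := tendsto_empMean_log_mixture_atBot hws hθs hU hemp hθ hw hC
      (hpeak.mono fun n hn i => hn i j) hj hlim
    obtain ⟨n, hn1, hn2⟩ := ((hlik 1 one_pos).and (hbot.eventually_lt_atBot _)).exists
    exact absurd hn1 (not_le.2 hn2)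
  set K := 4 * (C + δ⁻¹) with hK
  have hK₀ : 0 ≤ K := by positivity
  have hpeakK : ∀ᶠ n in (U : Filter ℕ), ∀ i, w n i * (θ n i).2⁻¹ ≤ K := by
    filter_upwards [hpeak, hδj] with n hn hδn i
    refine (hn i j).trans ?_
    rw [hK]
    gcongr
  obtain ⟨w₀, hw₀, hwlim⟩ := (isCompact_stdSimplex ℝ (Fin k)).ultrafilter_le_nhds (U.map w)
    (le_principal_iff.2 hw)
  have hwlim' : ∀ i, Tendsto (fun n => w n i) U (𝓝 (w₀ i)) := fun i =>
    ((continuous_apply i).tendsto w₀).comp (show Tendsto w U (𝓝 w₀) from hwlim)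
  -- the components whose parameters stay inside the parameter space, with their limits
  set I : Finset (Fin k) := Finset.univ.filter fun i =>
    ∃ q : ℝ × ℝ, 0 < q.2 ∧ Tendsto (fun n => θ n i) U (𝓝 q) with hI
  have hIin : ∀ i, ∃ q : ℝ × ℝ, i ∈ I → 0 < q.2 ∧ Tendsto (fun n => θ n i) U (𝓝 q) := by
    intro i
    by_cases hi : i ∈ I
    · obtain ⟨q, hq⟩ := (Finset.mem_filter.1 hi).2
      exact ⟨q, fun _ => hq⟩
    · exact ⟨0, fun h => absurd h hi⟩
  choose q hq using hIin
  have hIout : ∀ i, ∃ a, i ∉ I → ∀ S : Set ℝ, IsCompact S → a ∉ S → ∀ ε > 0,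
      ∀ᶠ n in (U : Filter ℕ), ∀ x ∈ S, w n i * gauss (θ n i) x ≤ ε := by
    intro i
    rcases component_dichotomy U (fun n => hθ n i)
      (hw.mono fun n hn => mem_Icc_of_mem_stdSimplex hn i) hK₀ (hpeakK.mono fun n hn => hn i)
      with h | ⟨a, ha⟩
    · exact ⟨0, fun hi => absurd (Finset.mem_filter.2 ⟨Finset.mem_univ i, h⟩) hi⟩
    · exact ⟨a, fun _ => ha⟩
  choose a ha using hIout
  set h : ℝ → ℝ := fun x => ∑ i ∈ I, w₀ i * gauss (q i) x with hh
  have hcont : Continuous h := continuous_finsetSum _ fun i _ => (continuous_gauss _).const_mul _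
  have h₀ : ∀ x, 0 ≤ h x := fun x =>
    Finset.sum_nonneg fun i _ => mul_nonneg (hw₀.1 i) (gauss_nonneg _ _)
  have hM : ∀ x, h x ≤ ∑ i ∈ I, w₀ i * (q i).2⁻¹ := fun x =>
    Finset.sum_le_sum fun i hi => mul_le_mul_of_nonneg_left (gauss_le_inv (hq i hi).1 x) (hw₀.1 i)
  have hint : Integrable h := integrable_finsetSum _ fun i _ => (integrable_gauss _).const_mul _
  have hmass : ∫ x, h x ≤ 1 := by
    rw [hh, integral_finsetSum _ fun i _ => (integrable_gauss _).const_mul _]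
    calc ∑ i ∈ I, ∫ x, w₀ i * gauss (q i) x = ∑ i ∈ I, w₀ i :=
          Finset.sum_congr rfl fun i hi => by
            rw [integral_const_mul, integral_gauss (hq i hi).1, mul_one]
      _ ≤ ∑ i, w₀ i :=
          Finset.sum_le_sum_of_subset_of_nonneg (Finset.subset_univ _) fun i _ _ => hw₀.1 i
      _ = 1 := hw₀.2
  have hcomp : ∀ S : Set ℝ, IsCompact S → (∀ x ∈ S, x ∉ Set.range a) → ∀ ε > 0,
      ∀ᶠ n in (U : Filter ℕ), ∀ x ∈ S, mixture (w n) (θ n) x ≤ h x + ε := by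
    intro S hS hSa ε hε
    have hterm : ∀ i, ∀ᶠ n in (U : Filter ℕ), ∀ x ∈ S, w n i * gauss (θ n i) x ≤
        (if i ∈ I then w₀ i * gauss (q i) x else 0) + ε / k := by
      intro i
      split_ifs with hi
      · have hnear : ∀ᶠ z in 𝓝 (w₀ i, q i), ∀ x ∈ S,
            z.1 * gauss z.2 x < w₀ i * gauss (q i) x + ε / k := by
          refine hS.eventually_forall_of_forall_eventually fun x _ => ?_
          have c1 : ContinuousAt (fun z : (ℝ × (ℝ × ℝ)) × ℝ => z.1.1 * gauss z.1.2 z.2)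
              ((w₀ i, q i), x) :=
            ContinuousAt.mul (by fun_prop)
              (ContinuousAt.comp (g := fun z : (ℝ × ℝ) × ℝ => gauss z.1 z.2)
                (f := fun z : (ℝ × (ℝ × ℝ)) × ℝ => (z.1.2, z.2)) (x := ((w₀ i, q i), x))
                (continuousAt_gauss (hq i hi).1 x) (by fun_prop))
          have c2 : ContinuousAt (fun z : (ℝ × (ℝ × ℝ)) × ℝ => w₀ i * gauss (q i) z.2 + ε / k)
              ((w₀ i, q i), x) :=
            (((continuous_gauss (q i)).comp continuous_snd).const_mul _
              |>.add_const _).continuousAt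
          refine c1.eventually_lt c2 ?_
          have : 0 < ε / k := by positivity
          simp only
          linarith
        filter_upwards [((hwlim' i).prodMk_nhds (hq i hi).2).eventually hnear] with n hn x hx
        exact (hn x hx).le
      · simpa using ha i hi S hS (fun h => hSa _ h ⟨i, rfl⟩) (ε / k) (by positivity)
    filter_upwards [eventually_all.2 hterm] with n hn x hx
    calc mixture (w n) (θ n) x
        ≤ ∑ i, ((if i ∈ I then w₀ i * gauss (q i) x else 0) + ε / k) :=
          Finset.sum_le_sum fun i _ => hn i x hx
      _ = h x + ε := by
          rw [Finset.sum_add_distrib, Finset.sum_ite_mem, Finset.univ_inter]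
          simp [hh]
          field_simp
  have hbdd : ∀ᶠ n in (U : Filter ℕ), ∀ x, mixture (w n) (θ n) x ≤ k * K := by
    filter_upwards [hpeakK, hw] with n hn hwn x
    refine (mixture_le hwn.1 (hθ n) x).trans ((Finset.sum_le_sum fun i _ => hn i).trans ?_)
    simp
  have heq := eq_mixture_of_integral_log_le hws hθs hcont h₀ hM hint hmass fun ε hε =>
    integral_log_le_of_asymptotic_bound hws hθs hU hemp
      (hw.mono fun n hn => mixture_pos hn (hθ n)) hbdd hcont h₀ hM
      (Set.finite_range a) (Set.range_nonempty a) hcomp hlik hε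
  obtain ⟨π, hπ⟩ := exists_perm_of_mixture_eq hθs hinj hwpos (fun i hi => (hq i hi).1) heq
  refine ⟨π, fun i => ?_, fun i => ?_⟩
  · rw [← (hπ i).2.1]
    exact (hq (π i) (hπ i).1).2
  · rw [← (hπ i).2.2]
    exact hwlim' (π i)

/-! ### Labellings and lower bound of the likelihood -/

/-- A labelling that works along each ultrafilter yields a sequence of labellings: take the one
that minimizes the total distance at each index. -/
theorem exists_perm_seq {θ : ℕ → Fin k → ℝ × ℝ} {θs : Fin k → ℝ × ℝ} {w : ℕ → Fin k → ℝ}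
    {ws : Fin k → ℝ}
    (h : ∀ U : Ultrafilter ℕ, (U : Filter ℕ) ≤ atTop → ∃ π : Equiv.Perm (Fin k),
      (∀ i, Tendsto (fun n => θ n (π i)) U (𝓝 (θs i))) ∧
        ∀ i, Tendsto (fun n => w n (π i)) U (𝓝 (ws i))) :
    ∃ π : ℕ → Equiv.Perm (Fin k), (∀ i, Tendsto (fun n => θ n (π n i)) atTop (𝓝 (θs i))) ∧
      ∀ i, Tendsto (fun n => w n (π n i)) atTop (𝓝 (ws i)) := by
  set d : ℕ → Equiv.Perm (Fin k) → ℝ := fun n π =>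
    ∑ i, (dist (θ n (π i)) (θs i) + dist (w n (π i)) (ws i)) with hd
  choose π hπ using fun n => Finite.exists_min (d n)
  have hd₀ : ∀ n π, 0 ≤ d n π := fun n π => Finset.sum_nonneg fun i _ => by positivity
  have hlim : Tendsto (fun n => d n (π n)) atTop (𝓝 0) := by
    rw [tendsto_iff_ultrafilter]
    intro U hU
    obtain ⟨σ, hσ₁, hσ₂⟩ := h U hU
    have h1 : Tendsto (fun n => d n σ) U (𝓝 (∑ _i : Fin k, ((0 : ℝ) + 0))) :=
      tendsto_finsetSum _ fun i _ => (tendsto_iff_dist_tendsto_zero.1 (hσ₁ i)).add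
        (tendsto_iff_dist_tendsto_zero.1 (hσ₂ i))
    rw [add_zero, Finset.sum_const_zero] at h1
    exact squeeze_zero (fun n => hd₀ n _) (fun n => hπ n σ) h1
  have hterm : ∀ n i, dist (θ n (π n i)) (θs i) + dist (w n (π n i)) (ws i) ≤ d n (π n) :=
    fun n i => Finset.single_le_sum
      (f := fun i => dist (θ n (π n i)) (θs i) + dist (w n (π n i)) (ws i))
      (fun i _ => by positivity) (Finset.mem_univ i)
  refine ⟨π, fun i => ?_, fun i => ?_⟩
  · refine tendsto_iff_dist_tendsto_zero.2 (squeeze_zero (fun _ => dist_nonneg) (fun n => ?_) hlim)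
    linarith [hterm n i, dist_nonneg (x := w n (π n i)) (y := ws i)]
  · refine tendsto_iff_dist_tendsto_zero.2 (squeeze_zero (fun _ => dist_nonneg) (fun n => ?_) hlim)
    linarith [hterm n i, dist_nonneg (x := θ n (π n i)) (y := θs i)]

theorem classDist_le_of_perm {θ θ' : Fin k → ℝ × ℝ} (π : Equiv.Perm (Fin k)) :
    classDist θ θ' ≤ ∑ i, dist (θ (π i)) (θ' i) := by
  have hle : ∀ i, dist (θ (π i)) (θ' i) ≤ ∑ i, dist (θ (π i)) (θ' i) := fun i =>
    Finset.single_le_sum (f := fun i => dist (θ (π i)) (θ' i)) (fun i _ => dist_nonneg)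
      (Finset.mem_univ i)
  refine Metric.hausdorffDist_le_of_mem_dist (Finset.sum_nonneg fun i _ => dist_nonneg) ?_ ?_
  · rintro _ ⟨i, rfl⟩
    refine ⟨_, ⟨π.symm i, rfl⟩, ?_⟩
    simpa using hle (π.symm i)
  · rintro _ ⟨i, rfl⟩
    exact ⟨_, ⟨π i, rfl⟩, by rw [dist_comm]; exact hle i⟩

theorem ae_le_of_eLpNorm_top_lt {φ : ℝ → ℝ} {C : ℝ}
    (h : eLpNorm φ ∞ volume < ENNReal.ofReal C) : ∀ᵐ y, φ y ≤ max C 0 := by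
  rw [eLpNorm_exponent_top] at h
  filter_upwards [ae_le_eLpNormEssSup (f := φ) (μ := volume)] with y hy
  have h1 := hy.trans_lt h
  rw [Real.enorm_eq_ofReal_abs] at h1
  have h2 := (ENNReal.ofReal_lt_ofReal_iff_of_nonneg (abs_nonneg (φ y))).1 h1
  exact (le_abs_self _).trans (h2.le.trans (le_max_left _ _))

/-- Approximate maximizers have log-likelihood asymptotically at least the expected
log-likelihood at the truth, since the `L₂` weights at the true parameters are consistent. -/
theorem eventually_integral_log_sub_le_empMean {ws : Fin k → ℝ} (hwpos : ∀ i, 0 < ws i)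
    (hwsum : ∑ i, ws i = 1) {θs : Fin k → ℝ × ℝ} (hθs : θs ∈ paramSpace k) {y : ℕ → ℝ}
    (hemp : Tendsto (fun n => empMean n y fun x => Real.log (mixture ws θs x)) atTop
      (𝓝 (∫ x, Real.log (mixture ws θs x) ∂(mixtureLaw ws θs))))
    {u : ℕ → Fin k → ℝ} (hu : Tendsto u atTop (𝓝 ws))
    {ε : ℕ → ℝ} (hε : Tendsto ε atTop (𝓝 0)) {L : ℕ → ℝ}
    (hL : ∀ᶠ n in atTop, (empMean n y fun x => Real.log (mixture (u n) θs x)) - ε n ≤ L n)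
    {η : ℝ} (hη : 0 < η) :
    ∀ᶠ n in atTop, (∫ x, Real.log (mixture ws θs x) ∂(mixtureLaw ws θs)) - η ≤ L n := by
  have hws : ws ∈ stdSimplex ℝ (Fin k) := ⟨fun i => (hwpos i).le, hwsum⟩
  have hnear : ∀ᶠ n in atTop, ∀ i, Real.exp (-(η / 3)) * ws i ≤ u n i := by
    refine eventually_all.2 fun i => ?_
    refine (((continuous_apply i).tendsto ws).comp hu).eventually_const_le ?_
    exact mul_lt_of_lt_one_left (hwpos i) (by rw [← Real.exp_zero]; exact Real.exp_lt_exp.2 (by linarith))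
  filter_upwards [hnear, hL, hε.eventually_le_const (show 0 < η / 3 by positivity),
    hemp.eventually_const_le (sub_lt_self _ (show 0 < η / 3 by positivity)), eventually_gt_atTop 0]
    with n h1 h2 h3 h4 hn
  have h5 : empMean n y (fun x => -(η / 3) + Real.log (mixture ws θs x)) ≤
      empMean n y fun x => Real.log (mixture (u n) θs x) := by
    refine empMean_mono fun x => ?_
    have h6 : Real.exp (-(η / 3)) * mixture ws θs x ≤ mixture (u n) θs x := by
      simp only [mixture, Finset.mul_sum, ← mul_assoc]
      exact Finset.sum_le_sum fun i _ => mul_le_mul_of_nonneg_right (h1 i) (gauss_nonneg _ _)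
    have hf := mixture_pos hws hθs x
    have h7 := Real.log_le_log (by positivity) h6
    rwa [Real.log_mul (Real.exp_pos _).ne' hf.ne', Real.log_exp] at h7
  rw [empMean_add, empMean_const hn] at h5
  linarith

end

end GaussMix

/-! ### Consistency -/

theorem theorem1 {k : ℕ}
    -- the true parameters and weights
    (θstar : Fin k → ℝ × ℝ) (wstar : Fin k → ℝ)
    (hθstar : θstar ∈ GaussMix.paramSpace k) (hdistinct : Function.Injective θstar)
    (hwpos : ∀ i, 0 < wstar i) (hwsum : ∑ i, wstar i = 1)
    -- the i.i.d. observations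
    {Ω : Type*} [MeasurableSpace Ω] (P : Measure Ω) [IsProbabilityMeasure P]
    (Y : ℕ → Ω → ℝ) (hindep : iIndepFun Y P)
    (hlaw : ∀ t, HasLaw (Y t) (GaussMix.mixtureLaw wstar θstar) P)
    -- the density estimator
    (fhat : ℕ → Ω → ℝ → ℝ)
    (hdens : ∀ n, 0 < n → ∀ ω, GaussMix.IsL2Density (fhat n ω))
    (hconv : ∀ᵐ ω ∂P, Tendsto
      (fun n => GaussMix.l2dist (fhat n ω) (GaussMix.mixture wstar θstar)) atTop (𝓝 0))
    (hbound : ∃ C : ℝ, ∀ᵐ ω ∂P, ∀ᶠ n in atTop,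
      eLpNorm (fhat n ω) ∞ volume < ENNReal.ofReal C)
    -- the weights: any selection of minimizers
    (v : ℕ → Ω → (Fin k → ℝ × ℝ) → Fin k → ℝ)
    (hv : ∀ n, 0 < n → ∀ ω, ∀ θ ∈ GaussMix.paramSpace k,
      GaussMix.IsL2Weights (fhat n ω) θ (v n ω θ))
    -- the approximate maximizer of the pseudo-likelihood
    (ε : ℕ → ℝ) (hε : Tendsto ε atTop (𝓝 0))
    (θhat : ℕ → Ω → Fin k → ℝ × ℝ) (hθhat : ∀ n ω, θhat n ω ∈ GaussMix.paramSpace k)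
    (hmax : ∀ᵐ ω ∂P, ∀ᶠ n in atTop, ∀ θ ∈ GaussMix.paramSpace k,
      GaussMix.logPseudoLik n (fun t => Y t ω) (v n ω) θ - ε n ≤
        GaussMix.logPseudoLik n (fun t => Y t ω) (v n ω) (θhat n ω)) :
    (∀ᵐ ω ∂P, Tendsto (fun n => GaussMix.classDist (θhat n ω) θstar) atTop (𝓝 0)) ∧
    (∀ᵐ ω ∂P, ∃ π : ℕ → Equiv.Perm (Fin k),
      (∀ i, Tendsto (fun n => θhat n ω (π n i)) atTop (𝓝 (θstar i))) ∧
      (∀ i, Tendsto (fun n => v n ω (θhat n ω) (π n i)) atTop (𝓝 (wstar i)))) ∧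
    (∀ᵐ ω ∂P, Tendsto
      (fun n => GaussMix.l2dist (GaussMix.mixture (v n ω (θhat n ω)) (θhat n ω))
        (GaussMix.mixture wstar θstar)) atTop (𝓝 0)) := by
  have hws : wstar ∈ stdSimplex ℝ (Fin k) := ⟨fun i => (hwpos i).le, hwsum⟩
  have hprob := GaussMix.isProbabilityMeasure_mixtureLaw hws hθstar
  have hpos : ∀ᶠ n : ℕ in atTop, 0 < n := eventually_gt_atTop 0
  have hmain : ∀ᵐ ω ∂P, ∃ π : ℕ → Equiv.Perm (Fin k),
      (∀ i, Tendsto (fun n => θhat n ω (π n i)) atTop (𝓝 (θstar i))) ∧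
      (∀ i, Tendsto (fun n => v n ω (θhat n ω) (π n i)) atTop (𝓝 (wstar i))) := by
    obtain ⟨C, hC⟩ := hbound
    filter_upwards [hconv, hC, hmax, GaussMix.ae_forall_tendsto_empMean hindep hlaw,
      GaussMix.ae_tendsto_empMean hindep hlaw
        (Real.measurable_log.comp (GaussMix.continuous_mixture wstar θstar).measurable)
        (GaussMix.integrable_log_mixture hws hθstar)] with ω hconv hC hmax hemp hlog
    have hu : Tendsto (fun n => v n ω θstar) atTop (𝓝 wstar) :=
      GaussMix.tendsto_weights_of_l2dist hθstar hdistinct hwpos hwsum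
        (hpos.mono fun n hn => (hdens n hn ω).memLp) hconv
        (hpos.mono fun n hn => hv n hn ω θstar hθstar)
    have hw : ∀ᶠ n in atTop, GaussMix.IsL2Weights (fhat n ω) (θhat n ω) (v n ω (θhat n ω)) :=
      hpos.mono fun n hn => hv n hn ω _ (hθhat n ω)
    have hpeak : ∀ᶠ n in atTop, ∀ i j, v n ω (θhat n ω) i * (θhat n ω i).2⁻¹ ≤
        4 * (max C 0 + (θhat n ω j).2⁻¹) := by
      filter_upwards [hpos, hw, hC] with n hn hwn hCn i j
      exact hwn.weight_mul_inv_le (hdens n hn ω) (le_max_right _ _)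
        (GaussMix.ae_le_of_eLpNorm_top_lt hCn) (hθhat n ω) i j
    refine GaussMix.exists_perm_seq fun U hU => ?_
    exact GaussMix.exists_perm_tendsto_ultrafilter hwpos hwsum hθstar hdistinct hU hemp
      (fun n => hθhat n ω) (hU (hw.mono fun n hn => hn.1)) (le_max_right C 0) (hU hpeak)
      fun η hη => hU (GaussMix.eventually_integral_log_sub_le_empMean hwpos hwsum hθstar hlog hu hε
        (hmax.mono fun n hn => hn θstar hθstar) hη)
  refine ⟨?_, hmain, ?_⟩
  · filter_upwards [hmain] with ω hω
    obtain ⟨π, hπ, -⟩ := hω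
    refine squeeze_zero (fun n => Metric.hausdorffDist_nonneg)
      (fun n => GaussMix.classDist_le_of_perm (π n)) ?_
    simpa using tendsto_finsetSum Finset.univ fun i _ => tendsto_iff_dist_tendsto_zero.1 (hπ i)
  · filter_upwards [hmain] with ω hω
    obtain ⟨π, hπ, hπw⟩ := hω
    refine (GaussMix.tendsto_l2dist_mixture hθstar hπw hπ).congr fun n => ?_
    exact congrArg (GaussMix.l2dist · _)
      (GaussMix.mixture_comp_perm (v n ω (θhat n ω)) (θhat n ω) (π n))
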